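/- \textbf{Chromatic homology.} Let $G$ be a finite graph (parallel edges allowed) whose edge set is linearly ordered. An enhanced state of $G$ is a pair $S=(s,c)$, where $s\subseteq E(G)$ and $c$ assigns a colour $1$ or $x$ to each connected component of the spanning graph $[G:s]=(V(G),s)$; put $i(S)=\#s$ and let $j(S)$ be the number of components coloured $x$. For $i,j\in\mathbb Z$ let $C^{i,j}(G)$ be the free $\mathbb Z$-module on the enhanced states with $i(S)=i$, $j(S)=j$, and let $\partial\colon C^{i,j}(G)\to C^{i+1,j}(G)$ be given by $\partial S=\sum_{f\in E(G)\setminus s}(-1)^{n(f)}S_f$, where $n(f)$ is the number of edges of $s$ preceding $f$ and $S_f=(s\cup\{f\},c_f)$: if $f$ joins two different components of $[G:s]$, the new component gets the product of their colours in $\mathbb Z[x]/(x^2)$ (and $S_f=0$ if both are $x$); all other colours are unchanged. Let $H^{i,j}(G)$ be the cohomology of $(C^{*,j}(G),\partial)$ at $C^{i,j}(G)$, and let $H^i(G)=\ker\partial^i/\operatorname{im}\partial^{i-1}$ be the cohomology of the total complex $C^i(G)=\bigoplus_j C^{i,j}(G)$, so that $H^i(G)=\bigoplus_j H^{i,j}(G)$.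 For an edge $e$ of $G$ with two distinct ends, let $G-e$ be the deletion and $G/e$ the contraction, a graph with edge set $E(G)\setminus\{e\}$ (parallel edges are kept), both with the order inherited from $G$. Let $\alpha\colon C^{i,j}(G/e)\to C^{i+1,j}(G)$ be the chain map $(s,c)\mapsto(-1)^{\#\{f\in s\,:\,f>e\}}(s\cup\{e\},\tilde c)$, where each component of $[G:s\cup\{e\}]$ has the colour of its image in $G/e$, and let $\beta\colon C^{i,j}(G)\to C^{i,j}(G-e)$ be the chain map with $\beta(s,c)=(s,c)$ if $e\notin s$ and $\beta(s,c)=0$ if $e\in s$. \textbf{Theorem.} Let $n\ge 4$ and $2\le m\le n-1$. Let $G=K_{n-1}^m$ be the graph on the vertices $1,\dots,n$ that consists of the complete graph on $1,\dots,n-1$ and the edges $\{t,n\}$, $1\le t\le m$; its edges $\{a,b\}$, $a<b$, are ordered lexicographically by $(a,b)$. Let $e=\{m,n\}$. Then for all $i,j\in\mathbb Z$ with $i+j\in\{n-2,n-1,n\}$ the sequence $$0\to H^{i,j}(G/e)\xrightarrow{\alpha^*}H^{i+1,j}(G)\xrightarrow{\beta^*}H^{i+1,j}(G-e)\to 0$$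 is split exact, and, summing over $j$, for all $i\in\mathbb Z$ the sequence $$0\to H^{i}(G/e)\xrightarrow{\alpha^*}H^{i+1}(G)\xrightarrow{\beta^*}H^{i+1}(G-e)\to 0$$ is split exact. -/

import Mathlib

open scoped Graph

set_option linter.unusedSectionVars false

namespace ChromaticHomology

noncomputable section

/-! ### Enhanced states

Graphs are Mathlib's multigraphs `Graph α β` (vertices in `α`, edges in `β`, loops and parallel
edges allowed). The linear order on `β` is the order of the edges. -/

section States

variable {α β : Type*}

/-- The two colours `1` and `x`, which form a basis of `ℤ[x]/(x²)`. -/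
inductive Colour
  | one
  | x

/-- The connected components of the spanning graph `[G : s]`. -/
def Component (G : Graph α β) (s : Finset β) : Type _ :=
  Quot (fun u v : V(G) => (G.restrict (s : Set β)).Adj u v)

/-- The component of `[G : s]` containing the vertex `v`. -/
def component (G : Graph α β) (s : Finset β) (v : V(G)) : Component G s :=
  Quot.mk _ v

/-- An enhanced state `(s, c)` of `G`: a set `s` of edges and a colouring of the connected
components of `[G : s]`. The colouring is recorded as a function on vertices which takes the same
value at the two ends of every edge of `s`; see `componentColour`. -/
@[ext]
structure EnhancedState (G : Graph α β) where
  edges : Finset β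
  edges_subset : (edges : Set β) ⊆ E(G)
  colour : V(G) → Colour
  colour_eq : ∀ u v : V(G), (G.restrict (edges : Set β)).Adj u v → colour u = colour v

namespace EnhancedState

variable {G : Graph α β}

/-- The colour of a connected component of `[G : s]`. -/
def componentColour (S : EnhancedState G) : Component G S.edges → Colour :=
  Quot.lift S.colour S.colour_eq

/-- `j(S)`, the number of components coloured `x`. -/
def xCount (S : EnhancedState G) : ℕ :=
  Nat.card {K : Component G S.edges // S.componentColour K = Colour.x}

variable [DecidableEq β]

/-- Adding the edge `f` would multiply `x` by `x`: some component of `[G : s ∪ {f}]` contains two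
distinct components of `[G : s]` which are both coloured `x`. (A component of `[G : s ∪ {f}]` is
either a component of `[G : s]`, possibly with the edge `f` added to it, or the union of two
components of `[G : s]` which are joined by `f`.) -/
def Vanishes (S : EnhancedState G) (f : β) : Prop :=
  ∃ u v : V(G), S.colour u = Colour.x ∧ S.colour v = Colour.x ∧
    component G (insert f S.edges) u = component G (insert f S.edges) v ∧
    component G S.edges u ≠ component G S.edges v

open Classical in
/-- The enhanced state `S_f = (s ∪ {f}, c_f)`, for `f` such that no product `x · x` occurs: a
component of `[G : s ∪ {f}]` is coloured `x` if it contains a component of `[G : s]` coloured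
`x`, and `1` otherwise. -/
def addEdge (S : EnhancedState G) (f : E(G)) : EnhancedState G where
  edges := insert (f : β) S.edges
  edges_subset := by
    intro g hg
    rcases Finset.mem_insert.1 (Finset.mem_coe.1 hg) with rfl | h
    · exact f.2
    · exact S.edges_subset h
  colour v :=
    if ∃ u : V(G), component G (insert (f : β) S.edges) u = component G (insert (f : β) S.edges) v ∧
      S.colour u = Colour.x then Colour.x else Colour.one
  colour_eq u v h := by
    have : component G (insert (f : β) S.edges) u = component G (insert (f : β) S.edges) v :=
      Quot.sound h
    rw [this]

lemma colour_eq_of_component_eq (S : EnhancedState G) {u v : V(G)}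
    (h : component G S.edges u = component G S.edges v) : S.colour u = S.colour v :=
  congrArg S.componentColour h

lemma addEdge_colour_eq_x (S : EnhancedState G) (f : E(G)) (v : V(G)) :
    (S.addEdge f).colour v = Colour.x ↔ ∃ u : V(G),
      component G (insert (f : β) S.edges) u = component G (insert (f : β) S.edges) v ∧
        S.colour u = Colour.x := by
  unfold addEdge
  simp only
  split_ifs with h
  · exact ⟨fun _ => h, fun _ => rfl⟩
  · exact ⟨fun h' => h'.elim, fun h' => absurd h' h⟩

/-- Passing to a larger set of edges maps components to components. -/
lemma component_eq_of_subset {s t : Finset β} (hst : s ⊆ t) {u v : V(G)}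
    (h : component G s u = component G s v) : component G t u = component G t v := by
  let φ : Component G s → Component G t :=
    Quot.lift (component G t) (by
      rintro u v ⟨f, hf, h⟩
      exact Quot.sound ⟨f, Finset.mem_coe.2 (hst (Finset.mem_coe.1 hf)), h⟩)
  exact congrArg φ h

lemma xCount_addEdge (S : EnhancedState G) (f : E(G)) (hf : ¬ S.Vanishes f) :
    (S.addEdge f).xCount = S.xCount := by
  let φ : Component G S.edges → Component G (insert (f : β) S.edges) :=
    Quot.lift (component G _) fun u v h =>
      component_eq_of_subset (Finset.subset_insert _ _) (Quot.sound h)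
  have hφ : ∀ K, S.componentColour K = Colour.x →
      (S.addEdge f).componentColour (φ K) = Colour.x := by
    rintro ⟨u⟩ hu
    exact (addEdge_colour_eq_x S f u).2 ⟨u, rfl, hu⟩
  symm
  refine Nat.card_congr (Equiv.ofBijective
    (fun K => (⟨φ K.1, hφ K.1 K.2⟩ :
      {K : Component G (S.addEdge f).edges // (S.addEdge f).componentColour K = Colour.x})) ⟨?_, ?_⟩)
  · rintro ⟨⟨u⟩, hu⟩ ⟨⟨v⟩, hv⟩ h
    have h' : component G (insert (f : β) S.edges) u = component G (insert (f : β) S.edges) v :=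
      congrArg Subtype.val h
    apply Subtype.ext
    by_contra hne
    exact hf ⟨u, v, hu, hv, h', hne⟩
  · rintro ⟨⟨v⟩, hv⟩
    obtain ⟨u, huv, hu⟩ := (addEdge_colour_eq_x S f v).1 hv
    exact ⟨⟨component G _ u, hu⟩, Subtype.ext huv⟩

lemma vanishes_addEdge_iff (S : EnhancedState G) (f g : E(G)) :
    S.Vanishes f ∨ (S.addEdge f).Vanishes g ↔
      ∃ u v : V(G), S.colour u = Colour.x ∧ S.colour v = Colour.x ∧
        component G (insert (g : β) (insert (f : β) S.edges)) u =
          component G (insert (g : β) (insert (f : β) S.edges)) v ∧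
        component G S.edges u ≠ component G S.edges v := by
  have hsub : insert (f : β) S.edges ⊆ insert (g : β) (insert (f : β) S.edges) :=
    Finset.subset_insert _ _
  constructor
  · rintro (⟨u, v, hu, hv, h1, h2⟩ | ⟨u, v, hu, hv, h1, h2⟩)
    · exact ⟨u, v, hu, hv, component_eq_of_subset hsub h1, h2⟩
    · obtain ⟨u', hu', hu''⟩ := (addEdge_colour_eq_x S f u).1 hu
      obtain ⟨v', hv', hv''⟩ := (addEdge_colour_eq_x S f v).1 hv
      refine ⟨u', v', hu'', hv'', ?_, fun h => h2 ?_⟩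
      · exact (component_eq_of_subset hsub hu').trans
          (h1.trans (component_eq_of_subset hsub hv').symm)
      · exact hu'.symm.trans
          ((component_eq_of_subset (Finset.subset_insert _ _) h).trans hv')
  · rintro ⟨u, v, hu, hv, h1, h2⟩
    by_cases h : component G (insert (f : β) S.edges) u = component G (insert (f : β) S.edges) v
    · exact Or.inl ⟨u, v, hu, hv, h, h2⟩
    · exact Or.inr ⟨u, v, (addEdge_colour_eq_x S f u).2 ⟨u, rfl, hu⟩,
        (addEdge_colour_eq_x S f v).2 ⟨v, rfl, hv⟩, h1, h⟩

lemma addEdge_comm (S : EnhancedState G) (f g : E(G)) :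
    (S.addEdge f).addEdge g = (S.addEdge g).addEdge f := by
  have key : ∀ (f g : E(G)) (v : V(G)), ((S.addEdge f).addEdge g).colour v = Colour.x ↔
      ∃ u : V(G), component G (insert (g : β) (insert (f : β) S.edges)) u =
        component G (insert (g : β) (insert (f : β) S.edges)) v ∧ S.colour u = Colour.x := by
    intro f g v
    rw [addEdge_colour_eq_x]
    constructor
    · rintro ⟨u, h1, hu⟩
      obtain ⟨w, hw, hw'⟩ := (addEdge_colour_eq_x S f u).1 hu
      exact ⟨w, (component_eq_of_subset (Finset.subset_insert _ _) hw).trans h1, hw'⟩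
    · rintro ⟨u, h1, hu⟩
      exact ⟨u, h1, (addEdge_colour_eq_x S f u).2 ⟨u, rfl, hu⟩⟩
  apply EnhancedState.ext
  · exact Finset.insert_comm _ _ _
  · funext v
    have h := (key f g v).trans ((by rw [Finset.insert_comm]) : _ ↔ _) |>.trans (key g f v).symm
    rcases h1 : ((S.addEdge f).addEdge g).colour v with _ | _ <;>
      rcases h2 : ((S.addEdge g).addEdge f).colour v with _ | _ <;> simp_all

end EnhancedState

end States

/-! ### The chromatic complex and its homology -/

section Complex

variable {α β : Type*} [LinearOrder β]

/-- The free `ℤ`-module on all enhanced states of `G`. -/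
abbrev Cochain (G : Graph α β) : Type _ := EnhancedState G →₀ ℤ

/-- `C^{i,j}(G)`: spanned by the enhanced states with `i` edges and `j` components coloured `x`. -/
def bigradedPart (G : Graph α β) (i j : ℤ) : Submodule ℤ (Cochain G) :=
  Finsupp.supported ℤ ℤ {S | (S.edges.card : ℤ) = i ∧ (S.xCount : ℤ) = j}

/-- `C^i(G)`, the sum of the `C^{i,j}(G)` over all `j`: spanned by the enhanced states with `i`
edges. -/
def gradedPart (G : Graph α β) (i : ℤ) : Submodule ℤ (Cochain G) :=
  Finsupp.supported ℤ ℤ {S | (S.edges.card : ℤ) = i}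

open Classical in
/-- `S_f` as a cochain; it is `0` if a product `x · x = 0` occurs. -/
def addEdgeCochain {G : Graph α β} (S : EnhancedState G) (f : E(G)) : Cochain G :=
  if S.Vanishes f then 0 else Finsupp.single (S.addEdge f) 1

lemma supported_le_comap {G H : Graph α β} (φ : Cochain G →ₗ[ℤ] Cochain H)
    (p : Set (EnhancedState G)) (q : Set (EnhancedState H))
    (h : ∀ S ∈ p, φ (Finsupp.single S 1) ∈ Finsupp.supported ℤ ℤ q) :
    Finsupp.supported ℤ ℤ p ≤ (Finsupp.supported ℤ ℤ q).comap φ := by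
  rw [Finsupp.supported_eq_span_single, Submodule.span_le]
  rintro _ ⟨S, hS, rfl⟩
  exact h S hS

variable [Fintype β]

open Classical in
/-- The differential of a state: the sum over the edges `f` of `G` outside `s` of
`(-1)^{n(f)} S_f`, where `n(f)` is the number of edges of `s` that precede `f`. -/
def stateDifferential {G : Graph α β} (S : EnhancedState G) : Cochain G :=
  ∑ f : β, if h : f ∈ E(G) ∧ f ∉ S.edges then
    (-1 : ℤ) ^ (S.edges.filter (· < f)).card • addEdgeCochain S ⟨f, h.1⟩ else 0

/-- The differential; it maps `C^{i,j}(G)` into `C^{i+1,j}(G)`. -/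
def differential (G : Graph α β) : Cochain G →ₗ[ℤ] Cochain G :=
  Finsupp.linearCombination ℤ stateDifferential

lemma differential_single {G : Graph α β} (S : EnhancedState G) :
    differential G (Finsupp.single S 1) = stateDifferential S := by
  simp [differential]

/-- The differential has bidegree `(1, 0)`. -/
lemma differential_bigradedPart (G : Graph α β) (i j : ℤ) :
    bigradedPart G i j ≤ (bigradedPart G (i + 1) j).comap (differential G) := by
  apply supported_le_comap
  rintro S ⟨h1, h2⟩
  rw [differential_single]
  refine Submodule.sum_mem _ fun f _ => ?_
  split_ifs with h
  · refine Submodule.smul_mem _ _ ?_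
    unfold addEdgeCochain
    split_ifs with hv
    · exact Submodule.zero_mem _
    · refine Finsupp.single_mem_supported _ _ ⟨?_, ?_⟩
      · change ((insert f S.edges).card : ℤ) = i + 1
        rw [Finset.card_insert_of_notMem h.2]
        push_cast
        omega
      · rw [S.xCount_addEdge ⟨f, h.1⟩ hv]
        exact h2
  · exact Submodule.zero_mem _

open Classical in
/-- The differential squares to zero. -/
lemma differential_comp_differential (G : Graph α β) :
    differential G ∘ₗ differential G = 0 := by
  refine Finsupp.lhom_ext' fun S => LinearMap.ext_ring ?_
  simp only [LinearMap.comp_apply, Finsupp.lsingle_apply, LinearMap.zero_apply]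
  rw [differential_single]
  let T : β → β → Cochain G := fun f g =>
    if h : (f ∈ E(G) ∧ f ∉ S.edges) ∧ (g ∈ E(G) ∧ g ∉ insert f S.edges) then
      ((-1 : ℤ) ^ (S.edges.filter (· < f)).card *
        (-1 : ℤ) ^ ((insert f S.edges).filter (· < g)).card) •
      (if S.Vanishes f ∨ (S.addEdge ⟨f, h.1.1⟩).Vanishes g then 0 else
        Finsupp.single ((S.addEdge ⟨f, h.1.1⟩).addEdge ⟨g, h.2.1⟩) 1) else 0
  have hT : differential G (stateDifferential S) = ∑ f, ∑ g, T f g := by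
    rw [stateDifferential, map_sum]
    refine Finset.sum_congr rfl fun f _ => ?_
    by_cases hf : f ∈ E(G) ∧ f ∉ S.edges
    · rw [dif_pos hf, map_smul]
      unfold addEdgeCochain
      by_cases hv : S.Vanishes f
      · rw [if_pos hv, map_zero, smul_zero]
        symm
        refine Finset.sum_eq_zero fun g _ => ?_
        simp only [T, hv, true_or, if_true, smul_zero, dite_eq_ite, ite_self]
      · rw [if_neg hv, differential_single, stateDifferential, Finset.smul_sum]
        refine Finset.sum_congr rfl fun g _ => ?_
        by_cases hg : g ∈ E(G) ∧ g ∉ insert f S.edges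
        · rw [dif_pos (show g ∈ E(G) ∧ g ∉ (S.addEdge ⟨f, hf.1⟩).edges from hg), smul_smul]
          simp only [T, dif_pos (And.intro hf hg), hv, false_or]
          rfl
        · rw [dif_neg (show ¬ (g ∈ E(G) ∧ g ∉ (S.addEdge ⟨f, hf.1⟩).edges) from hg), smul_zero]
          simp only [T]
          rw [dif_neg (fun h => hg h.2)]
    · rw [dif_neg hf, map_zero]
      symm
      refine Finset.sum_eq_zero fun g _ => ?_
      simp only [T]
      rw [dif_neg (fun h => hf h.1)]
  have hanti : ∀ f g, T f g = - T g f := by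
    intro f g
    by_cases h : (f ∈ E(G) ∧ f ∉ S.edges) ∧ (g ∈ E(G) ∧ g ∉ insert f S.edges)
    · have hfg : f ≠ g := by
        rintro rfl
        exact h.2.2 (Finset.mem_insert_self _ _)
      have hg : g ∉ S.edges := fun h' => h.2.2 (Finset.mem_insert_of_mem h')
      have h' : (g ∈ E(G) ∧ g ∉ S.edges) ∧ (f ∈ E(G) ∧ f ∉ insert g S.edges) :=
        ⟨⟨h.2.1, hg⟩, h.1.1, by simp [hfg, h.1.2]⟩
      simp only [T]
      rw [dif_pos h, dif_pos h', ← neg_smul]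
      have hv : (S.Vanishes f ∨ (S.addEdge ⟨f, h.1.1⟩).Vanishes g) ↔
          (S.Vanishes g ∨ (S.addEdge ⟨g, h'.1.1⟩).Vanishes f) := by
        have h1 := S.vanishes_addEdge_iff ⟨f, h.1.1⟩ ⟨g, h'.1.1⟩
        have h2 := S.vanishes_addEdge_iff ⟨g, h'.1.1⟩ ⟨f, h.1.1⟩
        simp only at h1 h2
        rw [h1, h2, Finset.insert_comm]
      congr 1
      · rw [Finset.filter_insert, Finset.filter_insert]
        rcases lt_or_gt_of_ne hfg with hlt | hlt
        · rw [if_pos hlt, if_neg hlt.not_gt, Finset.card_insert_of_notMem (by simp [h.1.2])]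
          ring
        · rw [if_neg hlt.not_gt, if_pos hlt, Finset.card_insert_of_notMem (by simp [hg])]
          ring
      · rw [S.addEdge_comm ⟨f, h.1.1⟩ ⟨g, h'.1.1⟩]
        by_cases hw : S.Vanishes f ∨ (S.addEdge ⟨f, h.1.1⟩).Vanishes g
        · rw [if_pos hw, if_pos (hv.1 hw)]
        · rw [if_neg hw, if_neg (fun hw' => hw (hv.2 hw'))]
    · have h' : ¬ ((g ∈ E(G) ∧ g ∉ S.edges) ∧ (f ∈ E(G) ∧ f ∉ insert g S.edges)) := by
        simp only [Finset.mem_insert, not_or] at h ⊢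
        tauto
      simp only [T]
      rw [dif_neg h, dif_neg h', neg_zero]
  rw [hT]
  have hneg : ∑ f, ∑ g, T f g = - ∑ f, ∑ g, T f g := by
    conv_lhs => rw [Finset.sum_comm]
    rw [← Finset.sum_neg_distrib]
    refine Finset.sum_congr rfl fun f _ => ?_
    rw [← Finset.sum_neg_distrib]
    exact Finset.sum_congr rfl fun g _ => hanti g f
  exact self_eq_neg.1 hneg

end Complex

section Homology

variable {M N : Type*} [AddCommGroup M] [AddCommGroup N]

/-- For an endomorphism `d` and submodules `P`, `Q` (two consecutive terms of a complex): the
kernel of `d` on `Q` modulo the image of `P` under `d`. -/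
abbrev homologyAt (d : M →ₗ[ℤ] M) (P Q : Submodule ℤ M) : Type _ :=
  ↥(Q ⊓ LinearMap.ker d) ⧸ (P.map d).submoduleOf (Q ⊓ LinearMap.ker d)

/-- The map induced on homology by a linear map that commutes with the differentials and respects
the chosen terms of the complexes. -/
def homologyAtMap {d : M →ₗ[ℤ] M} {d' : N →ₗ[ℤ] N} {P Q : Submodule ℤ M} {P' Q' : Submodule ℤ N}
    (φ : M →ₗ[ℤ] N) (hd : φ ∘ₗ d = d' ∘ₗ φ) (hP : P ≤ P'.comap φ) (hQ : Q ≤ Q'.comap φ) :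
    homologyAt d P Q →ₗ[ℤ] homologyAt d' P' Q' :=
  Submodule.mapQ _ _
    (φ.restrict (p := Q ⊓ LinearMap.ker d) (q := Q' ⊓ LinearMap.ker d') (by
      rintro z ⟨hz, hz'⟩
      refine ⟨hQ hz, ?_⟩
      have := LinearMap.congr_fun hd z
      change d z = 0 at hz'
      change d' (φ z) = 0
      simp only [LinearMap.comp_apply, hz', map_zero] at this
      exact this.symm))
    (by
      rintro ⟨z, hz⟩ ⟨p, hp, hpz⟩
      exact ⟨φ p, hP hp, by
        have := LinearMap.congr_fun hd p
        simp only [LinearMap.comp_apply] at this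
        rw [← this, hpz]; rfl⟩)

variable {α β : Type*} [LinearOrder β] [Fintype β]

/-- `H^{i,j}(G)`. -/
abbrev bigradedHomology (G : Graph α β) (i j : ℤ) : Type _ :=
  homologyAt (differential G) (bigradedPart G (i - 1) j) (bigradedPart G i j)

/-- `H^i(G)`. -/
abbrev gradedHomology (G : Graph α β) (i : ℤ) : Type _ :=
  homologyAt (differential G) (gradedPart G (i - 1)) (gradedPart G i)

end Homology

/-! ### Deletion and contraction -/

section DeletionContraction

variable {α β : Type*}

/-- The deletion `G - e`. -/
abbrev deletion (G : Graph α β) (e : β) : Graph α β := G.deleteEdges {e}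

open Classical in
/-- The map that moves the vertex `b` to the vertex `a`. -/
def collapse (a b v : α) : α := if v = b then a else v

/-- The contraction `G / e`, for an edge `e` with ends `a` and `b`: delete `e` and identify `b` with
`a`. The other edges of `G` are kept, so parallel edges may arise. -/
abbrev contraction (G : Graph α β) (e : β) (a b : α) : Graph α β :=
  (G.deleteEdges {e}).map (collapse a b)

/-- The vertex of `G / e` that a vertex of `G` becomes. -/
def toContraction (G : Graph α β) (e : β) (a b : α) (v : V(G)) : V(contraction G e a b) :=
  ⟨collapse a b v, by
    rw [Graph.vertexSet_map]
    exact ⟨v, by simp, rfl⟩⟩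

variable {G : Graph α β} {e : β} {a b : α}

lemma toContraction_surjective (G : Graph α β) (e : β) (a b : α) :
    Function.Surjective (toContraction G e a b) := by
  rintro ⟨w, hw⟩
  rw [Graph.vertexSet_map] at hw
  obtain ⟨v, hv, rfl⟩ := hw
  exact ⟨⟨v, by simpa using hv⟩, rfl⟩

lemma collapse_mem (he : G.IsLink e a b) {v : α} (hv : v ∈ V(G)) : collapse a b v ∈ V(G) := by
  unfold collapse
  split_ifs
  · exact he.left_mem
  · exact hv

lemma collapse_eq (he : G.IsLink e a b) {u v : α} (h : G.IsLink e u v) :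
    collapse a b u = collapse a b v := by
  rcases he.eq_and_eq_or_eq_and_eq h with ⟨rfl, rfl⟩ | ⟨rfl, rfl⟩ <;> simp [collapse]

variable [DecidableEq β]

lemma component_collapse (he : G.IsLink e a b) (s : Finset β) (v : V(G)) :
    component G (insert e s) ⟨collapse a b v, collapse_mem he v.2⟩ =
      component G (insert e s) v := by
  by_cases hv : (v : α) = b
  · apply Quot.sound
    refine ⟨e, by simp, ?_⟩
    simpa [collapse, hv] using he
  · congr 1
    ext
    simp [collapse, hv]

lemma component_toContraction_iff (he : G.IsLink e a b) (s : Finset β) (hs : e ∉ s) (u v : V(G)) :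
    component (contraction G e a b) s (toContraction G e a b u) =
        component (contraction G e a b) s (toContraction G e a b v) ↔
      component G (insert e s) u = component G (insert e s) v := by
  constructor
  · intro h
    have key : ∀ w : V(contraction G e a b), (w : α) ∈ V(G) := by
      intro w
      obtain ⟨v, rfl⟩ := toContraction_surjective G e a b w
      exact collapse_mem he v.2
    let φ : Component (contraction G e a b) s → Component G (insert e s) :=
      Quot.lift (fun w => component G (insert e s) ⟨w, key w⟩) (by
        rintro ⟨w, hw⟩ ⟨w', hw'⟩ ⟨f, hf, p, q, hpq, hp, hq⟩
        simp only at hp hq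
        subst hp hq
        have hpq' : G.IsLink f p q := by
          have := hpq
          simp only [Graph.deleteEdges_isLink] at this
          exact this.1
        have h1 := component_collapse he s ⟨p, hpq'.left_mem⟩
        have h2 := component_collapse he s ⟨q, hpq'.right_mem⟩
        simp only at h1 h2 ⊢
        rw [h1, h2]
        exact Quot.sound ⟨f, by simpa using Or.inr hf, hpq'⟩)
    have := congrArg φ h
    change component G (insert e s) ⟨collapse a b u, _⟩ =
      component G (insert e s) ⟨collapse a b v, _⟩ at this
    rwa [component_collapse he s u, component_collapse he s v] at this
  · intro h
    let φ : Component G (insert e s) → Component (contraction G e a b) s :=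
      Quot.lift (fun w => component (contraction G e a b) s (toContraction G e a b w)) (by
        rintro u v ⟨f, hf, huv⟩
        by_cases hfe : f = e
        · subst hfe
          congr 1
          exact Subtype.ext (collapse_eq he huv)
        · have hf : f ∈ s := (Finset.mem_insert.1 (Finset.mem_coe.1 hf)).resolve_left hfe
          refine Quot.sound ⟨f, hf, u, v, ?_, rfl, rfl⟩
          simp only [Graph.deleteEdges_isLink]
          exact ⟨huv, hfe⟩)
    exact congrArg φ h

lemma notMem_edges_contraction (S : EnhancedState (contraction G e a b)) : e ∉ S.edges := by
  intro h
  have := S.edges_subset h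
  simp at this

/-- The enhanced state `(s ∪ {e}, c̃)` of `G` that belongs to the enhanced state `(s, c)` of
`G / e`: every component of `[G : s ∪ {e}]` has the colour of its image in `G / e`. -/
def liftState (he : G.IsLink e a b) (S : EnhancedState (contraction G e a b)) :
    EnhancedState G where
  edges := insert e S.edges
  edges_subset := by
    intro g hg
    rcases Finset.mem_insert.1 (Finset.mem_coe.1 hg) with rfl | h
    · exact he.edge_mem
    · have := S.edges_subset h
      simp at this
      exact this.1
  colour v := S.colour (toContraction G e a b v)
  colour_eq u v h := S.colour_eq_of_component_eq
    ((component_toContraction_iff he _ (notMem_edges_contraction S) u v).2 (Quot.sound h))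

lemma xCount_liftState (he : G.IsLink e a b) (S : EnhancedState (contraction G e a b)) :
    (liftState he S).xCount = S.xCount := by
  have hs := notMem_edges_contraction S
  let φ : Component G (insert e S.edges) → Component (contraction G e a b) S.edges :=
    Quot.lift (fun w => component (contraction G e a b) S.edges (toContraction G e a b w))
      (fun u v h => (component_toContraction_iff he _ hs u v).2 (Quot.sound h))
  have hφ : Function.Bijective φ := by
    constructor
    · rintro ⟨u⟩ ⟨v⟩ h
      exact (component_toContraction_iff he _ hs u v).1 h
    · rintro ⟨w⟩
      obtain ⟨v, rfl⟩ := toContraction_surjective G e a b w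
      exact ⟨component G _ v, rfl⟩
  refine Nat.card_congr (Equiv.subtypeEquiv (Equiv.ofBijective φ hφ) ?_)
  rintro ⟨v⟩
  exact Iff.rfl

/-- `β` on states: `(s, c)` with `e ∉ s` as an enhanced state of `G - e`. -/
def restrictState (S : EnhancedState G) (hS : e ∉ S.edges) : EnhancedState (deletion G e) where
  edges := S.edges
  edges_subset := by
    intro f hf
    simp only [Graph.edgeSet_deleteEdges]
    exact ⟨S.edges_subset hf, by rintro rfl; exact hS hf⟩
  colour v := S.colour ⟨v, by simpa using v.2⟩
  colour_eq := by
    rintro u v ⟨f, hf, h⟩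
    simp only [Graph.deleteEdges_isLink] at h
    exact S.colour_eq _ _ ⟨f, hf, h.1⟩

lemma component_deletion_iff (s : Finset β) (hs : e ∉ s) (u v : V(deletion G e)) :
    component (deletion G e) s u = component (deletion G e) s v ↔
      component G s ⟨u, by simpa using u.2⟩ = component G s ⟨v, by simpa using v.2⟩ := by
  constructor
  · intro h
    let φ : Component (deletion G e) s → Component G s :=
      Quot.lift (fun w => component G s ⟨w, by simpa using w.2⟩) (by
        rintro u v ⟨f, hf, h⟩
        simp only [Graph.deleteEdges_isLink] at h
        exact Quot.sound ⟨f, hf, h.1⟩)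
    exact congrArg φ h
  · intro h
    let φ : Component G s → Component (deletion G e) s :=
      Quot.lift (fun w => component (deletion G e) s ⟨w, by simp⟩) (by
        rintro u v ⟨f, hf, h⟩
        refine Quot.sound ⟨f, hf, ?_⟩
        simp only [Graph.deleteEdges_isLink]
        exact ⟨h, by rintro rfl; exact hs hf⟩)
    exact congrArg φ h

lemma xCount_restrictState (S : EnhancedState G) (hS : e ∉ S.edges) :
    (restrictState S hS).xCount = S.xCount := by
  let φ : Component (deletion G e) S.edges → Component G S.edges :=
    Quot.lift (fun w => component G S.edges ⟨w, by simpa using w.2⟩)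
      (fun u v h => (component_deletion_iff _ hS u v).1 (Quot.sound h))
  have hφ : Function.Bijective φ := by
    constructor
    · rintro ⟨u⟩ ⟨v⟩ h
      exact (component_deletion_iff _ hS u v).2 h
    · rintro ⟨w⟩
      exact ⟨component _ _ ⟨w, by simp⟩, rfl⟩
  refine Nat.card_congr (Equiv.subtypeEquiv (Equiv.ofBijective φ hφ) ?_)
  rintro ⟨v⟩
  exact Iff.rfl

end DeletionContraction

section ChainMaps

variable {α β : Type*} [LinearOrder β] {G : Graph α β} {e : β} {a b : α}

/-- The map `α : C^{i,j}(G / e) → C^{i+1,j}(G)`, which sends `(s, c)` to `± (s ∪ {e}, c̃)`. The sign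
is `(-1)` to the number of edges of `s` that come after `e`; it makes `α` commute with the
differentials, and it is `+1` if `e` is the last edge of `G`. -/
def alpha (he : G.IsLink e a b) : Cochain (contraction G e a b) →ₗ[ℤ] Cochain G :=
  Finsupp.linearCombination ℤ fun S =>
    (-1 : ℤ) ^ (S.edges.filter (e < ·)).card • Finsupp.single (liftState he S) 1

/-- The map `β : C^{i,j}(G) → C^{i,j}(G - e)`, which sends `S = (s, c)` to `S` if `e ∉ s` and to `0`
if `e ∈ s`. -/
def beta (G : Graph α β) (e : β) : Cochain G →ₗ[ℤ] Cochain (deletion G e) :=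
  Finsupp.linearCombination ℤ fun S =>
    if hS : e ∈ S.edges then 0 else Finsupp.single (restrictState S hS) 1

lemma alpha_single (he : G.IsLink e a b) (S : EnhancedState (contraction G e a b)) :
    alpha he (Finsupp.single S 1) =
      (-1 : ℤ) ^ (S.edges.filter (e < ·)).card • Finsupp.single (liftState he S) 1 := by
  simp [alpha]

lemma beta_single (S : EnhancedState G) :
    beta G e (Finsupp.single S 1) =
      if hS : e ∈ S.edges then 0 else Finsupp.single (restrictState S hS) 1 := by
  simp [beta]

lemma card_edges_liftState (he : G.IsLink e a b) (S : EnhancedState (contraction G e a b)) :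
    (liftState he S).edges.card = S.edges.card + 1 :=
  Finset.card_insert_of_notMem (notMem_edges_contraction S)

lemma alpha_bigradedPart (he : G.IsLink e a b) {i k j : ℤ} (hk : i + 1 = k) :
    bigradedPart (contraction G e a b) i j ≤ (bigradedPart G k j).comap (alpha he) := by
  apply supported_le_comap
  rintro S ⟨h1, h2⟩
  rw [alpha_single]
  refine Submodule.smul_mem _ _ (Finsupp.single_mem_supported _ _ ⟨?_, ?_⟩)
  · rw [card_edges_liftState]; push_cast; omega
  · rw [xCount_liftState]; exact h2

lemma alpha_gradedPart (he : G.IsLink e a b) {i k : ℤ} (hk : i + 1 = k) :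
    gradedPart (contraction G e a b) i ≤ (gradedPart G k).comap (alpha he) := by
  apply supported_le_comap
  intro S h1
  rw [alpha_single]
  refine Submodule.smul_mem _ _ (Finsupp.single_mem_supported _ _ ?_)
  change ((liftState he S).edges.card : ℤ) = k
  change (S.edges.card : ℤ) = i at h1
  rw [card_edges_liftState]; push_cast; omega

lemma beta_bigradedPart (G : Graph α β) (e : β) (i j : ℤ) :
    bigradedPart G i j ≤ (bigradedPart (deletion G e) i j).comap (beta G e) := by
  apply supported_le_comap
  rintro S ⟨h1, h2⟩
  rw [beta_single]
  split_ifs with hS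
  · exact Submodule.zero_mem _
  · refine Finsupp.single_mem_supported _ _ ⟨h1, ?_⟩
    rw [xCount_restrictState]; exact h2

lemma beta_gradedPart (G : Graph α β) (e : β) (i : ℤ) :
    gradedPart G i ≤ (gradedPart (deletion G e) i).comap (beta G e) := by
  apply supported_le_comap
  intro S h1
  rw [beta_single]
  split_ifs with hS
  · exact Submodule.zero_mem _
  · exact Finsupp.single_mem_supported _ _ h1

lemma vanishes_liftState (he : G.IsLink e a b) (S : EnhancedState (contraction G e a b)) (f : β)
    (hf : f ≠ e) : (liftState he S).Vanishes f ↔ S.Vanishes f := by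
  have hs := notMem_edges_contraction S
  have hs' : e ∉ insert f S.edges := by simp [hs, hf.symm]
  constructor
  · rintro ⟨u, v, hu, hv, h1, h2⟩
    refine ⟨toContraction G e a b u, toContraction G e a b v, hu, hv, ?_, ?_⟩
    · rw [component_toContraction_iff he _ hs', Finset.insert_comm]
      exact h1
    · rw [Ne, component_toContraction_iff he _ hs]
      exact h2
  · rintro ⟨u, v, hu, hv, h1, h2⟩
    obtain ⟨u, rfl⟩ := toContraction_surjective G e a b u
    obtain ⟨v, rfl⟩ := toContraction_surjective G e a b v
    refine ⟨u, v, hu, hv, ?_, ?_⟩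
    · rw [component_toContraction_iff he _ hs', Finset.insert_comm] at h1
      exact h1
    · rw [Ne, component_toContraction_iff he _ hs] at h2
      exact h2

lemma addEdge_liftState (he : G.IsLink e a b) (S : EnhancedState (contraction G e a b)) (f : β)
    (hfG : f ∈ E(G)) (hf' : f ∈ E(contraction G e a b)) (hf : f ≠ e) :
    (liftState he S).addEdge ⟨f, hfG⟩ = liftState he (S.addEdge ⟨f, hf'⟩) := by
  have hs' : e ∉ insert f S.edges := by simp [notMem_edges_contraction S, hf.symm]
  apply EnhancedState.ext
  · exact Finset.insert_comm _ _ _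
  · funext v
    simp only [EnhancedState.addEdge, liftState]
    congr 1
    rw [(toContraction_surjective G e a b).exists]
    simp only [component_toContraction_iff he _ hs']
    rw [Finset.insert_comm]

lemma vanishes_restrictState (S : EnhancedState G) (hS : e ∉ S.edges) (f : β) (hf : f ≠ e) :
    (restrictState S hS).Vanishes f ↔ S.Vanishes f := by
  have hs' : e ∉ insert f S.edges := by simp [hS, hf.symm]
  constructor
  · rintro ⟨u, v, hu, hv, h1, h2⟩
    exact ⟨_, _, hu, hv, (component_deletion_iff _ hs' u v).1 h1,
      fun h => h2 ((component_deletion_iff _ hS u v).2 h)⟩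
  · rintro ⟨u, v, hu, hv, h1, h2⟩
    refine ⟨⟨u, by simp⟩, ⟨v, by simp⟩, hu, hv, (component_deletion_iff _ hs' _ _).2 h1,
      fun h => h2 ((component_deletion_iff _ hS _ _).1 h)⟩

lemma addEdge_restrictState (S : EnhancedState G) (hS : e ∉ S.edges) (f : β)
    (hfG : f ∈ E(G)) (hf' : f ∈ E(deletion G e)) (hf : f ≠ e)
    (hS' : e ∉ (S.addEdge ⟨f, hfG⟩).edges) :
    (restrictState S hS).addEdge ⟨f, hf'⟩ = restrictState (S.addEdge ⟨f, hfG⟩) hS' := by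
  have hs' : e ∉ insert f S.edges := by simp [hS, hf.symm]
  apply EnhancedState.ext
  · rfl
  · funext v
    simp only [EnhancedState.addEdge, restrictState]
    congr 1
    have hsurj : Function.Surjective (fun w : V(deletion G e) => (⟨w, by simpa using w.2⟩ : V(G))) :=
      fun w => ⟨⟨w, by simp⟩, rfl⟩
    rw [hsurj.exists]
    simp only [component_deletion_iff _ hs']

variable [Fintype β]

lemma alpha_addEdgeCochain (he : G.IsLink e a b) (S : EnhancedState (contraction G e a b)) (f : β)
    (hfG : f ∈ E(G)) (hf' : f ∈ E(contraction G e a b)) (hf : f ≠ e) :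
    alpha he (addEdgeCochain S ⟨f, hf'⟩) =
      (-1 : ℤ) ^ ((insert f S.edges).filter (e < ·)).card •
        addEdgeCochain (liftState he S) ⟨f, hfG⟩ := by
  unfold addEdgeCochain
  have hv := vanishes_liftState he S f hf
  by_cases h : S.Vanishes f
  · rw [if_pos h, if_pos (hv.2 h), map_zero, smul_zero]
  · rw [if_neg h, if_neg (fun h' => h (hv.1 h')), alpha_single,
      addEdge_liftState he S f hfG hf' hf]
    rfl

lemma alpha_comp_differential (he : G.IsLink e a b) :
    alpha he ∘ₗ differential (contraction G e a b) = differential G ∘ₗ alpha he := by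
  refine Finsupp.lhom_ext' fun S => LinearMap.ext_ring ?_
  simp only [LinearMap.comp_apply, Finsupp.lsingle_apply]
  rw [differential_single, alpha_single, map_smul, differential_single]
  simp only [stateDifferential, map_sum, Finset.smul_sum]
  refine Finset.sum_congr rfl fun f _ => ?_
  have hiff : (f ∈ E(contraction G e a b) ∧ f ∉ S.edges) ↔
      (f ∈ E(G) ∧ f ∉ (liftState he S).edges) := by
    have : (liftState he S).edges = insert e S.edges := rfl
    simp [this, and_assoc]
  by_cases h : f ∈ E(contraction G e a b) ∧ f ∉ S.edges
  · have h' := hiff.1 h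
    have hfe : f ≠ e := by
      rintro rfl
      exact h'.2 (Finset.mem_insert_self _ _)
    rw [dif_pos h, dif_pos h', map_smul, alpha_addEdgeCochain he S f h'.1 h.1 hfe, smul_smul,
      smul_smul]
    congr 1
    have : (liftState he S).edges = insert e S.edges := rfl
    rw [this, Finset.filter_insert, Finset.filter_insert]
    split_ifs with hlt
    · rw [Finset.card_insert_of_notMem (by simp [h.2]),
        Finset.card_insert_of_notMem (by simp [notMem_edges_contraction S])]
      ring
    · ring
  · rw [dif_neg h, dif_neg (fun h' => h (hiff.2 h')), map_zero, smul_zero]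

lemma beta_addEdgeCochain (S : EnhancedState G) (hS : e ∉ S.edges) (f : β)
    (hfG : f ∈ E(G)) (hf' : f ∈ E(deletion G e)) (hf : f ≠ e) :
    beta G e (addEdgeCochain S ⟨f, hfG⟩) = addEdgeCochain (restrictState S hS) ⟨f, hf'⟩ := by
  have hs' : e ∉ (S.addEdge ⟨f, hfG⟩).edges := by
    change e ∉ insert f S.edges
    simp [hS, hf.symm]
  unfold addEdgeCochain
  have hv := vanishes_restrictState S hS f hf
  by_cases h : S.Vanishes f
  · rw [if_pos h, if_pos (hv.2 h), map_zero]
  · rw [if_neg h, if_neg (fun h' => h (hv.1 h')), beta_single, dif_neg hs', addEdge_restrictState S hS f hfG hf' hf]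

lemma beta_addEdgeCochain_of_mem (S : EnhancedState G) (f : E(G))
    (h : e ∈ insert (f : β) S.edges) : beta G e (addEdgeCochain S f) = 0 := by
  unfold addEdgeCochain
  split_ifs
  · simp
  · rw [beta_single]
    exact dif_pos h

lemma beta_comp_differential (G : Graph α β) (e : β) :
    beta G e ∘ₗ differential G = differential (deletion G e) ∘ₗ beta G e := by
  refine Finsupp.lhom_ext' fun S => LinearMap.ext_ring ?_
  simp only [LinearMap.comp_apply, Finsupp.lsingle_apply]
  rw [differential_single, beta_single]
  by_cases hS : e ∈ S.edges
  · rw [dif_pos hS, map_zero]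
    simp only [stateDifferential, map_sum]
    refine Finset.sum_eq_zero fun f _ => ?_
    split_ifs with h
    · rw [map_smul, beta_addEdgeCochain_of_mem _ _ (Finset.mem_insert_of_mem hS), smul_zero]
    · simp
  · rw [dif_neg hS, differential_single]
    simp only [stateDifferential, map_sum]
    refine Finset.sum_congr rfl fun f _ => ?_
    by_cases hfe : f = e
    · subst hfe
      rw [dif_neg (c := f ∈ E(deletion G f) ∧ _) (by simp)]
      split_ifs with h
      · rw [map_smul, beta_addEdgeCochain_of_mem (e := f) S ⟨f, h.1⟩ (Finset.mem_insert_self _ _),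
          smul_zero]
      · simp
    · by_cases h : f ∈ E(G) ∧ f ∉ S.edges
      · have h' : f ∈ E(deletion G e) ∧ f ∉ (restrictState S hS).edges := by
          refine ⟨?_, h.2⟩
          simp [h.1, hfe]
        rw [dif_pos h, dif_pos h', map_smul, beta_addEdgeCochain S hS f h.1 h'.1 hfe]
        rfl
      · have h' : ¬ (f ∈ E(deletion G e) ∧ f ∉ (restrictState S hS).edges) := by
          rintro ⟨h1, h2⟩
          refine h ⟨?_, h2⟩
          simp at h1
          exact h1.1
        rw [dif_neg h, dif_neg h', map_zero]

/-- `α* : H^{i,j}(G / e) → H^{i+1,j}(G)`. -/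
def alphaStar (he : G.IsLink e a b) (i j : ℤ) :
    bigradedHomology (contraction G e a b) i j →ₗ[ℤ] bigradedHomology G (i + 1) j :=
  homologyAtMap (alpha he) (alpha_comp_differential he)
    (alpha_bigradedPart he (by ring)) (alpha_bigradedPart he rfl)

/-- `β* : H^{i,j}(G) → H^{i,j}(G - e)`. -/
def betaStar (G : Graph α β) (e : β) (i j : ℤ) :
    bigradedHomology G i j →ₗ[ℤ] bigradedHomology (deletion G e) i j :=
  homologyAtMap (beta G e) (beta_comp_differential G e)
    (beta_bigradedPart G e _ _) (beta_bigradedPart G e _ _)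

/-- `α* : H^i(G / e) → H^{i+1}(G)`. -/
def alphaStarTotal (he : G.IsLink e a b) (i : ℤ) :
    gradedHomology (contraction G e a b) i →ₗ[ℤ] gradedHomology G (i + 1) :=
  homologyAtMap (alpha he) (alpha_comp_differential he)
    (alpha_gradedPart he (by ring)) (alpha_gradedPart he rfl)

/-- `β* : H^i(G) → H^i(G - e)`. -/
def betaStarTotal (G : Graph α β) (e : β) (i : ℤ) :
    gradedHomology G i →ₗ[ℤ] gradedHomology (deletion G e) i :=
  homologyAtMap (beta G e) (beta_comp_differential G e)
    (beta_gradedPart G e _) (beta_gradedPart G e _)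

end ChainMaps

/-- `0 → A → B → C → 0` is a split short exact sequence. -/
def IsSplitExact {A B C : Type*} [AddCommGroup A] [AddCommGroup B] [AddCommGroup C]
    (f : A →ₗ[ℤ] B) (g : B →ₗ[ℤ] C) : Prop :=
  Function.Injective f ∧ Function.Exact f g ∧ Function.Surjective g ∧
    ∃ σ : C →ₗ[ℤ] B, g ∘ₗ σ = LinearMap.id

/-! ### The graph `K_{n-1}^m` -/

/-- The pairs `(a, b)`, `a < b`, that are edges of `K_{n-1}^m`. The vertex `k ∈ {1, …, n}` is the
element `k - 1` of `Fin n`: either both ends are among the first `n - 1` vertices, or `b` is the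
last vertex and `a` is one of the first `m` vertices. -/
def IsEdgeK (n m : ℕ) (p : Fin n ×ₗ Fin n) : Prop :=
  (ofLex p).1 < (ofLex p).2 ∧
    (((ofLex p).2 : ℕ) + 1 < n ∨ ((ofLex p).2 : ℕ) + 1 = n ∧ ((ofLex p).1 : ℕ) < m)

/-- The graph `K_{n-1}^m`: the complete graph on the first `n - 1` vertices, together with a last
vertex joined to the first `m` vertices. An edge is the pair `(a, b)` of its ends with `a < b`, and
the edges are ordered lexicographically. -/
def graphK (n m : ℕ) : Graph (Fin n) (Fin n ×ₗ Fin n) where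
  vertexSet := Set.univ
  edgeSet := {p | IsEdgeK n m p}
  IsLink p u v := IsEdgeK n m p ∧ (ofLex p = (u, v) ∨ ofLex p = (v, u))
  isLink_symm p _ := ⟨fun _ _ h => ⟨h.1, h.2.symm⟩⟩
  eq_or_eq_of_isLink_of_isLink := by
    rintro p x y v w ⟨-, h | h⟩ ⟨-, h' | h'⟩ <;> rw [h, Prod.mk.injEq] at h' <;> tauto
  edge_mem_iff_exists_isLink p :=
    ⟨fun h => ⟨(ofLex p).1, (ofLex p).2, h, Or.inl rfl⟩, fun ⟨_, _, h⟩ => h.1⟩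
  left_mem_of_isLink _ _ _ _ := Set.mem_univ _

/-- The edge `{m, n}` of `K_{n-1}^m`. -/
lemma graphK_isLink {n m : ℕ} (hmn : m < n) {a b : Fin n} (ha : (a : ℕ) + 1 = m)
    (hb : (b : ℕ) + 1 = n) : (graphK n m).IsLink (toLex (a, b)) a b := by
  refine ⟨⟨?_, Or.inr ⟨hb, ?_⟩⟩, Or.inl rfl⟩
  · change a < b
    rw [Fin.lt_def]
    omega
  · change (a : ℕ) < m
    omega

end

end ChromaticHomology

/-! The maps `alpha` and `beta` form a short exact sequence of complexes, so it is enough to find a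
section of `beta` that is a chain map of bidegree (0, 0). It then induces a splitting of the
homology sequence in each bidegree and in the total grading. The inclusion of C(G-e) into C(G) is a
section degree by degree; it fails to be a chain map by the term z ↦ e_e z that adds the edge e, and
this term has to be removed by a homotopy.

The computation takes place in the exterior algebra on the edges tensored with ℤ[x_v]/(x_v²) over
the vertices. There C(G) is the quotient by `relations`, and the differential is multiplication by
the sum of all e_f. For an edge f = uv, removing f and multiplying by x_u + x_v (`comulEdge`)
descends to the quotient and is a homotopy from multiplication by x_u + x_v to zero. Along a path b,
u, p, a, the alternating sum (x_u + x_b) - (x_u + x_p) + (x_p + x_a) telescopes, so multiplication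
by x_a + x_b is null-homotopic.

Where b is isolated, adding e = ab is obtained from multiplication by x_a + x_b: take the
coefficient of x_b and then multiply by e_e (`mergeEdge`). Hence `pathHomotopy` corrects the
inclusion up to terms whose edge set contains e and another edge at b (`pathHomotopy_defect_mem`).
These terms span a contractible complex (`exists_contraction`): if f = tb and e = ab are both
present, the third side ta of the triangle can be added or removed without changing any component. A
perturbation (`exists_chain_section`) absorbs what remains and gives `exists_section_beta`.

In K_{n-1}^m with e = {m, n}, every other neighbour of n is a neighbour of m, which gives the
triangles. The bounds m ≥ 2 and n ≥ 4 give the path of length three from n to m. -/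

namespace ChromaticHomology

noncomputable section

/-! ### Monomial cochains

The free `ℤ`-module on the monomials `e_s x_M`, where `s` is a set of edges and `M` a set of
vertices, with the operators that add or remove an edge, and multiply or divide by a variable. -/

section Monomials

/-- The free `ℤ`-module on the monomials `e_s x_M`. -/
abbrev MonomialCochain (V β : Type*) : Type _ := (Finset β × Finset V) →₀ ℤ

variable {V β : Type*} {N : Type*} [AddCommGroup N]

/-- The monomial `e_s x_M`. -/
def monomial (s : Finset β) (M : Finset V) : MonomialCochain V β := Finsupp.single (s, M) 1

/-- The linear map with prescribed values on the monomials. -/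
def monomialLift (φ : Finset β → Finset V → N) : MonomialCochain V β →ₗ[ℤ] N :=
  Finsupp.linearCombination ℤ fun p => φ p.1 p.2

@[simp]
lemma monomialLift_monomial (φ : Finset β → Finset V → N) (s : Finset β) (M : Finset V) :
    monomialLift φ (monomial s M) = φ s M := by
  simp [monomialLift, monomial]

/-- The span of the monomials `e_s x_M` for which `A s M` holds. -/
def monomialSpan (A : Finset β → Finset V → Prop) : Submodule ℤ (MonomialCochain V β) :=
  Finsupp.supported ℤ ℤ {p | A p.1 p.2}

lemma monomial_mem_span {A : Finset β → Finset V → Prop} {s : Finset β} {M : Finset V}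
    (h : A s M) : monomial s M ∈ monomialSpan A :=
  Finsupp.single_mem_supported _ _ h

lemma monomialSpan_le_comap {A : Finset β → Finset V → Prop} (φ : MonomialCochain V β →ₗ[ℤ] N)
    (L : Submodule ℤ N) (h : ∀ s M, A s M → φ (monomial s M) ∈ L) :
    monomialSpan A ≤ L.comap φ := by
  rw [monomialSpan, Finsupp.supported_eq_span_single, Submodule.span_le]
  rintro _ ⟨⟨s, M⟩, hS, rfl⟩
  exact h s M hS

lemma map_mem_of_mem_monomialSpan {A : Finset β → Finset V → Prop}
    (φ : MonomialCochain V β →ₗ[ℤ] N) (L : Submodule ℤ N)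
    (h : ∀ s M, A s M → φ (monomial s M) ∈ L) {z : MonomialCochain V β}
    (hz : z ∈ monomialSpan A) : φ z ∈ L :=
  monomialSpan_le_comap φ L h hz

lemma map_mem_of_forall_monomial (φ : MonomialCochain V β →ₗ[ℤ] N)
    (L : Submodule ℤ N) (h : ∀ s M, φ (monomial s M) ∈ L) (z : MonomialCochain V β) :
    φ z ∈ L := by
  have hz : z ∈ monomialSpan (fun _ _ => True) := by
    rw [monomialSpan, Finsupp.mem_supported]
    exact fun _ _ => trivial
  exact monomialSpan_le_comap φ L (fun s M _ => h s M) hz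

lemma monomial_ext {φ ψ : MonomialCochain V β →ₗ[ℤ] N}
    (h : ∀ s M, φ (monomial s M) = ψ (monomial s M)) : φ = ψ := by
  ext ⟨s, M⟩
  exact h s M

lemma eq_of_mem_monomialSpan {A : Finset β → Finset V → Prop} {φ ψ : MonomialCochain V β →ₗ[ℤ] N}
    (h : ∀ s M, A s M → φ (monomial s M) = ψ (monomial s M)) {z : MonomialCochain V β}
    (hz : z ∈ monomialSpan A) : φ z = ψ z := by
  have := monomialSpan_le_comap (φ - ψ) ⊥
    (fun s M hs => by simp [h s M hs]) hz
  simpa [sub_eq_zero] using this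

open Classical in
/-- The projection to the monomials `e_s x_M` for which `A s` holds. -/
def edgeProj (V : Type*) (A : Finset β → Prop) :
    MonomialCochain V β →ₗ[ℤ] MonomialCochain V β :=
  monomialLift fun s M => if A s then monomial s M else 0

lemma edgeProj_of_pos {A : Finset β → Prop} {s : Finset β} (h : A s) (M : Finset V) :
    edgeProj V A (monomial s M) = monomial s M := by
  simp [edgeProj, h]

lemma edgeProj_of_neg {A : Finset β → Prop} {s : Finset β} (h : ¬ A s) (M : Finset V) :
    edgeProj V A (monomial s M) = 0 := by
  simp [edgeProj, h]

/-! ### Multiplication by a variable and its coefficient -/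

section Variables

variable [DecidableEq V]

/-- Multiplication by the variable `x_v`, with `x_v² = 0`. -/
def mulVar (β : Type*) (v : V) : MonomialCochain V β →ₗ[ℤ] MonomialCochain V β :=
  monomialLift fun s M => if v ∈ M then 0 else monomial s (insert v M)

/-- The coefficient of the variable `x_v`. -/
def coeffVar (β : Type*) (v : V) : MonomialCochain V β →ₗ[ℤ] MonomialCochain V β :=
  monomialLift fun s M => if v ∈ M then monomial s (M.erase v) else 0

lemma mulVar_monomial (v : V) (s : Finset β) (M : Finset V) :
    mulVar β v (monomial s M) = if v ∈ M then 0 else monomial s (insert v M) := by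
  simp [mulVar]

lemma coeffVar_monomial (v : V) (s : Finset β) (M : Finset V) :
    coeffVar β v (monomial s M) = if v ∈ M then monomial s (M.erase v) else 0 := by
  simp [coeffVar]

lemma mulVar_mulVar_self (v : V) (z : MonomialCochain V β) : mulVar β v (mulVar β v z) = 0 := by
  suffices h : mulVar β v ∘ₗ mulVar β v = 0 from LinearMap.congr_fun h z
  refine monomial_ext fun s M => ?_
  by_cases h : v ∈ M <;> simp [mulVar_monomial, h]

lemma mulVar_comm (u v : V) (z : MonomialCochain V β) :
    mulVar β u (mulVar β v z) = mulVar β v (mulVar β u z) := by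
  suffices h : mulVar β u ∘ₗ mulVar β v = mulVar β v ∘ₗ mulVar β u from LinearMap.congr_fun h z
  rcases eq_or_ne u v with rfl | huv
  · rfl
  refine monomial_ext fun s M => ?_
  by_cases h : v ∈ M <;> by_cases h' : u ∈ M <;>
    simp [mulVar_monomial, h, h', huv, huv.symm, Finset.insert_comm]

lemma coeffVar_mulVar_of_ne {u v : V} (huv : u ≠ v) (z : MonomialCochain V β) :
    coeffVar β u (mulVar β v z) = mulVar β v (coeffVar β u z) := by
  suffices h : coeffVar β u ∘ₗ mulVar β v = mulVar β v ∘ₗ coeffVar β u from LinearMap.congr_fun h z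
  refine monomial_ext fun s M => ?_
  by_cases h : v ∈ M <;> by_cases h' : u ∈ M <;>
    simp [mulVar_monomial, coeffVar_monomial, h, h', huv, huv.symm, Finset.erase_insert_of_ne]

/-- Write z = z₀ + x_v z₁ with z₀, z₁ free of x_v. Since x_v² = 0, the coefficient of x_v in x_v z
is z₀. -/
lemma coeffVar_mulVar_self (v : V) (z : MonomialCochain V β) :
    coeffVar β v (mulVar β v z) = z - mulVar β v (coeffVar β v z) := by
  suffices h : coeffVar β v ∘ₗ mulVar β v = LinearMap.id - mulVar β v ∘ₗ coeffVar β v from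
    LinearMap.congr_fun h z
  refine monomial_ext fun s M => ?_
  by_cases h : v ∈ M <;> simp [mulVar_monomial, coeffVar_monomial, h]

end Variables

/-! ### Exterior multiplication and contraction by an edge -/

section Edges

variable [LinearOrder β]

/-- The sign `(-1)^{n(f)}`, where `n(f)` is the number of elements of `s` that precede `f`. -/
def edgeSign (f : β) (s : Finset β) : ℤ := (-1) ^ (s.filter (· < f)).card

lemma edgeSign_mul_self (f : β) (s : Finset β) : edgeSign f s * edgeSign f s = 1 := by
  rw [edgeSign, ← mul_pow]; simp

lemma edgeSign_insert_self (f : β) (s : Finset β) : edgeSign f (insert f s) = edgeSign f s := by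
  simp [edgeSign, Finset.filter_insert]

lemma edgeSign_erase_self (f : β) (s : Finset β) : edgeSign f (s.erase f) = edgeSign f s := by
  by_cases h : f ∈ s
  · conv_rhs => rw [← Finset.insert_erase h, edgeSign_insert_self]
  · rw [Finset.erase_eq_of_notMem h]

lemma edgeSign_insert {f g : β} {s : Finset β} (hg : g ∉ s) :
    edgeSign f (insert g s) = (if g < f then -1 else 1) * edgeSign f s := by
  unfold edgeSign
  rw [Finset.filter_insert]
  split_ifs with h
  · rw [Finset.card_insert_of_notMem (by simp [hg]), pow_succ]; ring
  · simp

/-- Exactly one of f and g precedes the other, so exactly one of the two signs changes. All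
anticommutation rules below rest on this. -/
lemma edgeSign_insert_mul {f g : β} {s : Finset β} (hfg : f ≠ g) (hf : f ∉ s) (hg : g ∉ s) :
    edgeSign f (insert g s) * edgeSign g (insert f s) = - (edgeSign f s * edgeSign g s) := by
  rw [edgeSign_insert hf, edgeSign_insert hg]
  rcases lt_or_gt_of_ne hfg with h | h
  · rw [if_neg h.not_gt, if_pos h]; ring
  · rw [if_pos h, if_neg h.not_gt]; ring

lemma edgeSign_mul_edgeSign_insert {f g : β} {s : Finset β} (hfg : f ≠ g) (hf : f ∉ s)
    (hg : g ∉ s) : edgeSign f s * edgeSign g (insert f s) =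
      - (edgeSign g s * edgeSign f (insert g s)) := by
  have h1 := edgeSign_insert_mul hfg hf hg
  have h2 := edgeSign_mul_self f s
  have h5 := edgeSign_mul_self f (insert g s)
  calc edgeSign f s * edgeSign g (insert f s)
      = (edgeSign f (insert g s) * edgeSign g (insert f s)) * edgeSign f s *
          edgeSign f (insert g s) := by
        linear_combination (-edgeSign f s * edgeSign g (insert f s)) * h5
    _ = _ := by rw [h1]; linear_combination (-edgeSign g s * edgeSign f (insert g s)) * h2

variable (V) in
/-- Left multiplication by `e_f`. -/
def mulEdge (f : β) : MonomialCochain V β →ₗ[ℤ] MonomialCochain V β :=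
  monomialLift fun s M => if f ∈ s then 0 else edgeSign f s • monomial (insert f s) M

variable (V) in
/-- The contraction by `e_f`, which removes `f`. -/
def removeEdge (f : β) : MonomialCochain V β →ₗ[ℤ] MonomialCochain V β :=
  monomialLift fun s M => if f ∈ s then edgeSign f s • monomial (s.erase f) M else 0

lemma mulEdge_monomial (f : β) (s : Finset β) (M : Finset V) :
    mulEdge V f (monomial s M) =
      if f ∈ s then 0 else edgeSign f s • monomial (insert f s) M := by
  simp [mulEdge]

lemma removeEdge_monomial (f : β) (s : Finset β) (M : Finset V) :
    removeEdge V f (monomial s M) =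
      if f ∈ s then edgeSign f s • monomial (s.erase f) M else 0 := by
  simp [removeEdge]

lemma mulEdge_mulEdge (f g : β) (z : MonomialCochain V β) :
    mulEdge V f (mulEdge V g z) = - mulEdge V g (mulEdge V f z) := by
  suffices h : mulEdge V f ∘ₗ mulEdge V g = - (mulEdge V g ∘ₗ mulEdge V f) from
    LinearMap.congr_fun h z
  refine monomial_ext fun s M => ?_
  rcases eq_or_ne f g with rfl | hfg
  · by_cases h : f ∈ s <;> simp [mulEdge_monomial, h]
  by_cases h : f ∈ s <;> by_cases h' : g ∈ s <;>
    simp [mulEdge_monomial, h, h', hfg, hfg.symm, smul_smul]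
  rw [edgeSign_mul_edgeSign_insert hfg.symm h' h, Finset.insert_comm, neg_smul]

lemma mulEdge_mulEdge_self (f : β) (z : MonomialCochain V β) :
    mulEdge V f (mulEdge V f z) = 0 :=
  self_eq_neg.1 (mulEdge_mulEdge f f z)

/-- The exterior product with e_f and the interior product by e_f have anticommutator 1; for
distinct edges the anticommutator is 0. These two rules make the removal of an edge a homotopy. -/
lemma removeEdge_mulEdge_self (f : β) (z : MonomialCochain V β) :
    removeEdge V f (mulEdge V f z) + mulEdge V f (removeEdge V f z) = z := by
  suffices h : removeEdge V f ∘ₗ mulEdge V f + mulEdge V f ∘ₗ removeEdge V f = LinearMap.id from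
    LinearMap.congr_fun h z
  refine monomial_ext fun s M => ?_
  by_cases h : f ∈ s <;>
    simp [mulEdge_monomial, removeEdge_monomial, h, smul_smul, edgeSign_insert_self,
      edgeSign_erase_self, edgeSign_mul_self]

lemma removeEdge_mulEdge_of_ne {f g : β} (hfg : f ≠ g) (z : MonomialCochain V β) :
    removeEdge V f (mulEdge V g z) + mulEdge V g (removeEdge V f z) = 0 := by
  suffices h : removeEdge V f ∘ₗ mulEdge V g + mulEdge V g ∘ₗ removeEdge V f = 0 from
    LinearMap.congr_fun h z
  refine monomial_ext fun s M => ?_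
  by_cases h : f ∈ s <;> by_cases h' : g ∈ s <;>
    simp [mulEdge_monomial, removeEdge_monomial, h, h', hfg, hfg.symm, smul_smul]
  obtain ⟨t, ht, rfl⟩ : ∃ t, f ∉ t ∧ s = insert f t :=
    ⟨s.erase f, by simp, (Finset.insert_erase h).symm⟩
  have hg : g ∉ t := fun h => h' (Finset.mem_insert_of_mem h)
  rw [Finset.erase_insert ht, Finset.insert_comm, Finset.erase_insert (by simp [hfg, ht]),
    edgeSign_insert_self, edgeSign_insert_self, ← add_smul, mul_comm,
    edgeSign_insert_mul hfg ht hg, neg_add_cancel, zero_smul]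

variable [DecidableEq V]

lemma mulEdge_mulVar (f : β) (v : V) (z : MonomialCochain V β) :
    mulEdge V f (mulVar β v z) = mulVar β v (mulEdge V f z) := by
  suffices h : mulEdge V f ∘ₗ mulVar β v = mulVar β v ∘ₗ mulEdge V f from LinearMap.congr_fun h z
  refine monomial_ext fun s M => ?_
  by_cases h : f ∈ s <;> by_cases h' : v ∈ M <;> simp [mulEdge_monomial, mulVar_monomial, h, h']

lemma mulEdge_coeffVar (f : β) (v : V) (z : MonomialCochain V β) :
    mulEdge V f (coeffVar β v z) = coeffVar β v (mulEdge V f z) := by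
  suffices h : mulEdge V f ∘ₗ coeffVar β v = coeffVar β v ∘ₗ mulEdge V f from
    LinearMap.congr_fun h z
  refine monomial_ext fun s M => ?_
  by_cases h : f ∈ s <;> by_cases h' : v ∈ M <;> simp [mulEdge_monomial, coeffVar_monomial, h, h']

lemma removeEdge_mulVar (f : β) (v : V) (z : MonomialCochain V β) :
    removeEdge V f (mulVar β v z) = mulVar β v (removeEdge V f z) := by
  suffices h : removeEdge V f ∘ₗ mulVar β v = mulVar β v ∘ₗ removeEdge V f from
    LinearMap.congr_fun h z
  refine monomial_ext fun s M => ?_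
  by_cases h : f ∈ s <;> by_cases h' : v ∈ M <;>
    simp [removeEdge_monomial, mulVar_monomial, h, h']

end Edges

end Monomials

/-! ### The chromatic complex as a quotient of the monomial cochains -/

section Presentation

open scoped Classical

variable {α β : Type*} [LinearOrder β]

/-- The relations of the chromatic complex: the variables of the two ends of an edge of `s` agree
on `e_s`, and `e_s = 0` unless `s` consists of edges of `G`. -/
def relations (G : Graph α β) : Submodule ℤ (MonomialCochain V(G) β) :=
  Submodule.span ℤ
    ({z | ∃ (s : Finset β) (M : Finset V(G)), ¬ (s : Set β) ⊆ E(G) ∧ z = monomial s M} ∪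
      {z | ∃ (s : Finset β) (M : Finset V(G)), ∃ f ∈ s, ∃ u v : V(G), G.IsLink f u v ∧
        z = mulVar β u (monomial s M) - mulVar β v (monomial s M)})

/-- The endomorphism `φ` preserves the relations of the chromatic complex of `G`. -/
def RespectsRelations (G : Graph α β)
    (φ : MonomialCochain V(G) β →ₗ[ℤ] MonomialCochain V(G) β) : Prop :=
  ∀ z ∈ relations G, φ z ∈ relations G

/-- The enhanced state with edges `s` in which the components meeting `M` are coloured `x`. -/
def markedState (G : Graph α β) (s : Finset β) (hs : (s : Set β) ⊆ E(G)) (M : Finset V(G)) :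
    EnhancedState G where
  edges := s
  edges_subset := hs
  colour v := if ∃ w ∈ M, component G s w = component G s v then Colour.x else Colour.one
  colour_eq u v h := by
    have : component G s u = component G s v := Quot.sound h
    rw [this]

/-- The cochain that a monomial represents. -/
def toCochain (G : Graph α β) : MonomialCochain V(G) β →ₗ[ℤ] Cochain G :=
  monomialLift fun s M =>
    if h : (s : Set β) ⊆ E(G) ∧ Set.InjOn (component G s) (M : Set V(G)) then
      Finsupp.single (markedState G s h.1 M) 1 else 0

/-- A representative of the component of `[G : s]` containing the vertex `v`. -/
def root (G : Graph α β) (s : Finset β) (v : V(G)) : V(G) := Quot.out (component G s v)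

variable {G : Graph α β}

lemma monomial_mem_relations {s : Finset β} (hs : ¬ (s : Set β) ⊆ E(G)) (M : Finset V(G)) :
    monomial s M ∈ relations G :=
  Submodule.subset_span (Or.inl ⟨s, M, hs, rfl⟩)

lemma mulVar_sub_mem_relations {s : Finset β} {f : β} (hf : f ∈ s) {u v : V(G)}
    (h : G.IsLink f u v) (M : Finset V(G)) :
    mulVar β u (monomial s M) - mulVar β v (monomial s M) ∈ relations G :=
  Submodule.subset_span (Or.inr ⟨s, M, f, hf, u, v, h, rfl⟩)

lemma relations_le_comap {N : Type*} [AddCommGroup N] (φ : MonomialCochain V(G) β →ₗ[ℤ] N)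
    (L : Submodule ℤ N)
    (h₁ : ∀ (s : Finset β) (M : Finset V(G)), ¬ (s : Set β) ⊆ E(G) → φ (monomial s M) ∈ L)
    (h₂ : ∀ (s : Finset β) (M : Finset V(G)), ∀ f ∈ s, ∀ u v : V(G), G.IsLink f u v →
      φ (mulVar β u (monomial s M) - mulVar β v (monomial s M)) ∈ L) :
    relations G ≤ L.comap φ := by
  rw [relations, Submodule.span_le]
  rintro _ (⟨s, M, hs, rfl⟩ | ⟨s, M, f, hf, u, v, h, rfl⟩)
  · exact h₁ s M hs
  · exact h₂ s M f hf u v h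

lemma respectsRelations_of {φ : MonomialCochain V(G) β →ₗ[ℤ] MonomialCochain V(G) β}
    (h₁ : ∀ (s : Finset β) (M : Finset V(G)), ¬ (s : Set β) ⊆ E(G) →
      φ (monomial s M) ∈ relations G)
    (h₂ : ∀ (s : Finset β) (M : Finset V(G)), ∀ f ∈ s, ∀ u v : V(G), G.IsLink f u v →
      φ (mulVar β u (monomial s M) - mulVar β v (monomial s M)) ∈ relations G) :
    RespectsRelations G φ :=
  fun _ hz => relations_le_comap φ _ h₁ h₂ hz

lemma RespectsRelations.comp {φ ψ : MonomialCochain V(G) β →ₗ[ℤ] MonomialCochain V(G) β}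
    (hφ : RespectsRelations G φ) (hψ : RespectsRelations G ψ) : RespectsRelations G (φ ∘ₗ ψ) :=
  fun z hz => hφ _ (hψ z hz)

lemma RespectsRelations.add {φ ψ : MonomialCochain V(G) β →ₗ[ℤ] MonomialCochain V(G) β}
    (hφ : RespectsRelations G φ) (hψ : RespectsRelations G ψ) : RespectsRelations G (φ + ψ) :=
  fun z hz => Submodule.add_mem _ (hφ z hz) (hψ z hz)

lemma RespectsRelations.sub {φ ψ : MonomialCochain V(G) β →ₗ[ℤ] MonomialCochain V(G) β}
    (hφ : RespectsRelations G φ) (hψ : RespectsRelations G ψ) : RespectsRelations G (φ - ψ) :=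
  fun z hz => Submodule.sub_mem _ (hφ z hz) (hψ z hz)

lemma RespectsRelations.id : RespectsRelations G LinearMap.id := fun _ hz => hz

lemma mulVar_relations (w : V(G)) : RespectsRelations G (mulVar β w) := by
  refine respectsRelations_of (fun s M hs => ?_) fun s M f hf u v h => ?_
  · rw [mulVar_monomial]
    split_ifs
    · exact Submodule.zero_mem _
    · exact monomial_mem_relations hs _
  · rw [map_sub, mulVar_comm w u, mulVar_comm w v, mulVar_monomial w]
    split_ifs
    · simp
    · exact mulVar_sub_mem_relations hf h _

lemma mulEdge_relations (f : β) : RespectsRelations G (mulEdge V(G) f) := by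
  refine respectsRelations_of (fun s M hs => ?_) fun s M g hg u v h => ?_
  · rw [mulEdge_monomial]
    split_ifs
    · exact Submodule.zero_mem _
    · refine Submodule.smul_mem _ _ (monomial_mem_relations (fun h => hs fun x hx => h ?_) _)
      simpa using Or.inr hx
  · rw [map_sub, mulEdge_mulVar, mulEdge_mulVar, mulEdge_monomial]
    split_ifs
    · simp
    · rw [map_smul, map_smul, ← smul_sub]
      exact Submodule.smul_mem _ _ (mulVar_sub_mem_relations (Finset.mem_insert_of_mem hg) h _)

lemma component_root (s : Finset β) (v : V(G)) : component G s (root G s v) = component G s v :=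
  Quot.out_eq _

lemma root_eq_iff {s : Finset β} {u v : V(G)} :
    root G s u = root G s v ↔ component G s u = component G s v := by
  refine ⟨fun h => ?_, fun h => by rw [root, h, root]⟩
  rw [← component_root, h, component_root]

lemma toCochain_of_pos {s : Finset β} {M : Finset V(G)} (hs : (s : Set β) ⊆ E(G))
    (hM : Set.InjOn (component G s) (M : Set V(G))) :
    toCochain G (monomial s M) = Finsupp.single (markedState G s hs M) 1 := by
  rw [toCochain, monomialLift_monomial, dif_pos ⟨hs, hM⟩]

lemma toCochain_of_neg {s : Finset β} {M : Finset V(G)}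
    (h : ¬ ((s : Set β) ⊆ E(G) ∧ Set.InjOn (component G s) (M : Set V(G)))) :
    toCochain G (monomial s M) = 0 := by
  rw [toCochain, monomialLift_monomial, dif_neg h]

lemma markedState_colour_eq_x {s : Finset β} (hs : (s : Set β) ⊆ E(G)) (M : Finset V(G))
    (v : V(G)) : (markedState G s hs M).colour v = Colour.x ↔
      ∃ w ∈ M, component G s w = component G s v := by
  simp only [markedState]
  split_ifs with h
  · exact ⟨fun _ => h, fun _ => rfl⟩
  · exact ⟨fun h' => h'.elim, fun h' => absurd h' h⟩

lemma xCount_markedState {s : Finset β} (hs : (s : Set β) ⊆ E(G)) {M : Finset V(G)}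
    (hM : Set.InjOn (component G s) (M : Set V(G))) :
    (markedState G s hs M).xCount = M.card := by
  have hcard : Nat.card (M : Set V(G)) = M.card := by simp
  rw [← hcard]
  symm
  refine Nat.card_congr (Equiv.ofBijective (fun v : (M : Set V(G)) =>
    (⟨component G s v, (markedState_colour_eq_x hs M v).2 ⟨v, v.2, rfl⟩⟩ :
      {K : Component G (markedState G s hs M).edges //
        (markedState G s hs M).componentColour K = Colour.x})) ⟨?_, ?_⟩)
  · intro u v h
    exact Subtype.ext (hM u.2 v.2 (congrArg Subtype.val h))
  · rintro ⟨⟨v⟩, hv⟩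
    obtain ⟨w, hw, h⟩ := (markedState_colour_eq_x hs M v).1 hv
    exact ⟨⟨w, hw⟩, Subtype.ext h⟩

lemma colour_eq_of_iff {c c' : Colour} (h : c = Colour.x ↔ c' = Colour.x) : c = c' := by
  cases c <;> cases c' <;> simp_all

lemma markedState_congr {s : Finset β} (hs : (s : Set β) ⊆ E(G)) {M M' : Finset V(G)}
    (h : Set.image (component G s) M = Set.image (component G s) M') :
    markedState G s hs M = markedState G s hs M' := by
  apply EnhancedState.ext
  · rfl
  · funext v
    refine colour_eq_of_iff ?_
    rw [markedState_colour_eq_x, markedState_colour_eq_x]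
    have := Set.ext_iff.1 h (component G s v)
    simpa using this

/-- The defining relations concern single edges; they add up along a walk. -/
lemma mulVar_sub_mem_relations_of_component {s : Finset β} {u v : V(G)}
    (h : component G s u = component G s v) (M : Finset V(G)) :
    mulVar β u (monomial s M) - mulVar β v (monomial s M) ∈ relations G := by
  replace h := Quot.eqvGen_exact h
  induction h with
  | rel u v h =>
    obtain ⟨f, hf, h⟩ := h
    exact mulVar_sub_mem_relations hf h M
  | refl u => simp
  | symm u v h ih =>
    rw [← neg_sub]
    exact Submodule.neg_mem _ ih
  | trans u v w h h' ih ih' =>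
    rw [← sub_add_sub_cancel _ (mulVar β v (monomial s M))]
    exact Submodule.add_mem _ ih ih'

/-- The image of x_u e_s x_M depends on u only through its component: it is zero if that component
already meets M, and otherwise the component receives colour x. -/
lemma relations_le_ker_toCochain : relations G ≤ LinearMap.ker (toCochain G) := by
  refine relations_le_comap _ ⊥ (fun s M hs => ?_) fun s M f hf u v h => ?_
  · rw [Submodule.mem_bot]
    exact toCochain_of_neg fun h => hs h.1
  · have huv : component G s u = component G s v := Quot.sound ⟨f, hf, h⟩
    rw [Submodule.mem_bot, map_sub, sub_eq_zero]
    by_cases hs : (s : Set β) ⊆ E(G)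
    swap
    · rw [mulVar_monomial, mulVar_monomial]
      split_ifs <;> simp [toCochain_of_neg (fun h : _ ∧ _ => hs h.1)]
    have key : ∀ u : V(G), toCochain G (mulVar β u (monomial s M)) =
        if h : Set.InjOn (component G s) (M : Set V(G)) ∧
          component G s u ∉ Set.image (component G s) (M : Set V(G)) then
          Finsupp.single (markedState G s hs (insert u M)) 1 else 0 := by
      intro u
      rw [mulVar_monomial]
      split_ifs with h1 h2 h2
      · exact absurd ⟨u, h1, rfl⟩ h2.2
      · simp
      · refine toCochain_of_pos hs ?_
        rw [Finset.coe_insert, Set.injOn_insert (by simpa using h1)]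
        exact h2
      · refine toCochain_of_neg fun h => h2 ?_
        have := h.2
        rw [Finset.coe_insert, Set.injOn_insert (by simpa using h1)] at this
        exact this
    rw [key, key]
    rw [markedState_congr hs (M := insert u M) (M' := insert v M)
      (by simp [Set.image_insert_eq, huv])]
    simp only [huv]

/-- Normal form modulo the relations: each marked vertex may be moved to the root of its component.
If a component is marked twice, moving the second mark to the root produces a square, so the
monomial is itself a relation. -/
lemma monomial_sub_mem_relations (s : Finset β) (M : Finset V(G)) :
    monomial s M - (if Set.InjOn (component G s) (M : Set V(G)) then
      monomial s (M.image (root G s)) else 0) ∈ relations G := by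
  induction M using Finset.induction_on with
  | empty => simp
  | insert v M hv ih =>
    have h1 := mulVar_relations v _ ih
    have h2 : monomial s (insert v M) = mulVar β v (monomial s M) := by
      rw [mulVar_monomial, if_neg hv]
    rw [map_sub, ← h2] at h1
    rw [← sub_add_sub_cancel _ (mulVar β v (if Set.InjOn (component G s) (M : Set V(G)) then
      monomial s (M.image (root G s)) else 0))]
    refine Submodule.add_mem _ h1 ?_
    have hins : Set.InjOn (component G s) ((insert v M : Finset V(G)) : Set V(G)) ↔
        Set.InjOn (component G s) (M : Set V(G)) ∧
          component G s v ∉ Set.image (component G s) (M : Set V(G)) := by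
      rw [Finset.coe_insert, Set.injOn_insert (by simpa using hv)]
    simp only [hins]
    by_cases hM : Set.InjOn (component G s) (M : Set V(G))
    swap
    · simp [hM]
    have h3 := mulVar_sub_mem_relations_of_component (component_root s v).symm (M.image (root G s))
    have h4 : mulVar β (root G s v) (monomial s (M.image (root G s))) =
        if component G s v ∉ Set.image (component G s) (M : Set V(G)) then
          monomial s ((insert v M).image (root G s)) else 0 := by
      rw [mulVar_monomial, Finset.image_insert]
      have : root G s v ∈ M.image (root G s) ↔
          component G s v ∈ Set.image (component G s) (M : Set V(G)) := by
        simp [root_eq_iff]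
      by_cases h : root G s v ∈ M.image (root G s)
      · rw [if_pos h, if_neg (not_not.2 (this.1 h))]
      · rw [if_neg h, if_pos (fun h' => h (this.2 h'))]
    rw [h4] at h3
    simpa [hM] using h3

/-! ### The differential as exterior multiplication -/

section Differential

variable [Fintype β]

/-- The differential on monomial cochains: multiplication by the sum of the `e_f`. -/
def monomialDifferential (G : Graph α β) : MonomialCochain V(G) β →ₗ[ℤ] MonomialCochain V(G) β :=
  ∑ f : β, if f ∈ E(G) then mulEdge V(G) f else 0

lemma monomialDifferential_apply (z : MonomialCochain V(G) β) :
    monomialDifferential G z = ∑ f : β, if f ∈ E(G) then mulEdge V(G) f z else 0 := by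
  rw [monomialDifferential, LinearMap.sum_apply]
  refine Finset.sum_congr rfl fun f _ => ?_
  split_ifs <;> rfl

/-- In terms of monomials a new edge leaves M unchanged. The product x · x occurs exactly when f
brings two vertices of M into one component, which is when the new monomial represents zero. -/
lemma addEdgeCochain_markedState {s : Finset β} (hs : (s : Set β) ⊆ E(G)) {M : Finset V(G)}
    (hM : Set.InjOn (component G s) (M : Set V(G))) (f : E(G)) :
    addEdgeCochain (markedState G s hs M) f = toCochain G (monomial (insert (f : β) s) M) := by
  have hs' : ((insert (f : β) s : Finset β) : Set β) ⊆ E(G) := by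
    rw [Finset.coe_insert]
    exact Set.insert_subset f.2 hs
  have hv : (markedState G s hs M).Vanishes f ↔
      ¬ Set.InjOn (component G (insert (f : β) s)) (M : Set V(G)) := by
    constructor
    · rintro ⟨u, v, hu, hv, h1, h2⟩ hinj
      obtain ⟨u', hu', hu⟩ := (markedState_colour_eq_x hs M u).1 hu
      obtain ⟨v', hv', hv⟩ := (markedState_colour_eq_x hs M v).1 hv
      have hsub := Finset.subset_insert (f : β) s
      have : u' = v' := hinj hu' hv'
        ((EnhancedState.component_eq_of_subset hsub hu).trans
          (h1.trans (EnhancedState.component_eq_of_subset hsub hv).symm))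
      subst this
      exact h2 (hu.symm.trans hv)
    · intro h
      simp only [Set.InjOn, not_forall] at h
      obtain ⟨u, hu, v, hv, h1, h2⟩ := h
      exact ⟨u, v, (markedState_colour_eq_x hs M u).2 ⟨u, hu, rfl⟩,
        (markedState_colour_eq_x hs M v).2 ⟨v, hv, rfl⟩, h1, fun h => h2 (hM hu hv h)⟩
  unfold addEdgeCochain
  by_cases h : Set.InjOn (component G (insert (f : β) s)) (M : Set V(G))
  · rw [if_neg (fun h' => hv.1 h' h), toCochain_of_pos hs' h]
    congr 1
    apply EnhancedState.ext
    · rfl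
    · funext v
      refine colour_eq_of_iff ?_
      rw [EnhancedState.addEdge_colour_eq_x, markedState_colour_eq_x]
      constructor
      · rintro ⟨u, hu, hux⟩
        obtain ⟨w, hw, hwu⟩ := (markedState_colour_eq_x hs M u).1 hux
        exact ⟨w, hw, (EnhancedState.component_eq_of_subset
          (Finset.subset_insert (f : β) s) hwu).trans hu⟩
      · rintro ⟨w, hw, hwv⟩
        exact ⟨w, hwv, (markedState_colour_eq_x hs M w).2 ⟨w, hw, rfl⟩⟩
  · rw [if_pos (hv.2 h), toCochain_of_neg (fun h' => h h'.2)]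

lemma differential_toCochain (z : MonomialCochain V(G) β) :
    differential G (toCochain G z) = toCochain G (monomialDifferential G z) := by
  suffices h : differential G ∘ₗ toCochain G = toCochain G ∘ₗ monomialDifferential G from
    LinearMap.congr_fun h z
  refine monomial_ext fun s M => ?_
  rw [LinearMap.comp_apply, LinearMap.comp_apply, monomialDifferential_apply, map_sum]
  by_cases h : (s : Set β) ⊆ E(G) ∧ Set.InjOn (component G s) (M : Set V(G))
  · rw [toCochain_of_pos h.1 h.2, differential_single, stateDifferential]
    refine Finset.sum_congr rfl fun f _ => ?_
    by_cases hfE : f ∈ E(G)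
    swap
    · rw [dif_neg (fun h => hfE h.1), if_neg hfE, map_zero]
    rw [if_pos hfE, mulEdge_monomial]
    by_cases hfs : f ∈ s
    · rw [dif_neg (fun h => h.2 hfs), if_pos hfs, map_zero]
    · rw [dif_pos (show f ∈ E(G) ∧ f ∉ (markedState G s h.1 M).edges from ⟨hfE, hfs⟩), if_neg hfs,
        map_smul, addEdgeCochain_markedState h.1 h.2]
      rfl
  · rw [toCochain_of_neg h, map_zero]
    symm
    refine Finset.sum_eq_zero fun f _ => ?_
    split_ifs
    · rw [mulEdge_monomial]
      split_ifs
      · simp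
      · rw [map_smul, toCochain_of_neg, smul_zero]
        rintro ⟨h1, h2⟩
        have hsub := Finset.subset_insert f s
        exact h ⟨fun x hx => h1 (hsub hx), fun u hu v hv huv =>
          h2 hu hv (EnhancedState.component_eq_of_subset hsub huv)⟩
    · simp

lemma monomialDifferential_comp_self (z : MonomialCochain V(G) β) :
    monomialDifferential G (monomialDifferential G z) = 0 := by
  have key : monomialDifferential G (monomialDifferential G z) =
      ∑ f : β, ∑ g : β, if f ∈ E(G) ∧ g ∈ E(G) then mulEdge V(G) f (mulEdge V(G) g z) else 0 := by
    rw [monomialDifferential_apply]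
    refine Finset.sum_congr rfl fun f _ => ?_
    split_ifs with hf
    · rw [monomialDifferential_apply, map_sum]
      refine Finset.sum_congr rfl fun g _ => ?_
      by_cases hg : g ∈ E(G) <;> simp [hf, hg]
    · simp [hf]
  rw [key]
  -- Exchanging f and g reverses the sign of the double sum, and a free ℤ-module has no 2-torsion.
  refine self_eq_neg.1 ?_
  conv_lhs => rw [Finset.sum_comm]
  simp only [← Finset.sum_neg_distrib]
  refine Finset.sum_congr rfl fun f _ => Finset.sum_congr rfl fun g _ => ?_
  by_cases hf : f ∈ E(G) <;> by_cases hg : g ∈ E(G) <;> simp [hf, hg, mulEdge_mulEdge g f z]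

lemma monomialDifferential_relations : RespectsRelations G (monomialDifferential G) := by
  intro z hz
  rw [monomialDifferential_apply]
  refine Submodule.sum_mem _ fun f _ => ?_
  split_ifs
  · exact mulEdge_relations f _ hz
  · exact Submodule.zero_mem _

end Differential

/-! ### Normal forms and induced endomorphisms -/

variable [Finite V(G)]

/-- The representatives of the components coloured `x`. -/
def EnhancedState.marks (S : EnhancedState G) : Finset V(G) :=
  (Set.toFinite {v | S.colour v = Colour.x ∧ root G S.edges v = v}).toFinset

lemma EnhancedState.mem_marks {S : EnhancedState G} {v : V(G)} :
    v ∈ S.marks ↔ S.colour v = Colour.x ∧ root G S.edges v = v := by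
  simp [EnhancedState.marks]

/-- The monomial that represents an enhanced state. -/
def toMonomial (G : Graph α β) [Finite V(G)] : Cochain G →ₗ[ℤ] MonomialCochain V(G) β :=
  Finsupp.linearCombination ℤ fun S => monomial S.edges S.marks

lemma toMonomial_single (S : EnhancedState G) :
    toMonomial G (Finsupp.single S 1) = monomial S.edges S.marks := by
  simp [toMonomial]

lemma EnhancedState.injOn_marks (S : EnhancedState G) :
    Set.InjOn (component G S.edges) (S.marks : Set V(G)) := by
  intro u hu v hv h
  rw [← (EnhancedState.mem_marks.1 hu).2, ← (EnhancedState.mem_marks.1 hv).2]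
  exact root_eq_iff.2 h

lemma EnhancedState.markedState_marks (S : EnhancedState G) :
    markedState G S.edges S.edges_subset S.marks = S := by
  apply EnhancedState.ext
  · rfl
  · funext v
    refine colour_eq_of_iff ?_
    rw [markedState_colour_eq_x]
    constructor
    · rintro ⟨w, hw, h⟩
      rw [← S.colour_eq_of_component_eq h]
      exact (EnhancedState.mem_marks.1 hw).1
    · intro h
      refine ⟨root G S.edges v, EnhancedState.mem_marks.2 ⟨?_, ?_⟩, component_root _ _⟩
      · rw [S.colour_eq_of_component_eq (component_root _ _)]; exact h
      · rw [root_eq_iff, component_root]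

lemma EnhancedState.card_marks (S : EnhancedState G) : S.marks.card = S.xCount := by
  conv_rhs => rw [← S.markedState_marks]
  exact (xCount_markedState _ S.injOn_marks).symm

lemma marks_markedState {s : Finset β} (hs : (s : Set β) ⊆ E(G)) (M : Finset V(G)) :
    (markedState G s hs M).marks = M.image (root G s) := by
  ext v
  rw [EnhancedState.mem_marks, markedState_colour_eq_x, Finset.mem_image]
  constructor
  · rintro ⟨⟨w, hw, h⟩, hv⟩
    exact ⟨w, hw, (root_eq_iff.2 h).trans hv⟩
  · rintro ⟨w, hw, rfl⟩
    exact ⟨⟨w, hw, (component_root _ _).symm⟩, root_eq_iff.2 (component_root _ _)⟩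

lemma toCochain_toMonomial (z : Cochain G) : toCochain G (toMonomial G z) = z := by
  suffices h : toCochain G ∘ₗ toMonomial G = LinearMap.id from LinearMap.congr_fun h z
  refine Finsupp.lhom_ext' fun S => LinearMap.ext_ring ?_
  simp only [LinearMap.comp_apply, Finsupp.lsingle_apply, toMonomial_single]
  rw [toCochain_of_pos S.edges_subset S.injOn_marks, S.markedState_marks]
  rfl

/-- Together with `relations_le_ker_toCochain` this identifies the kernel of `toCochain` with the
relations; since `toMonomial` is a right inverse of `toCochain`, C(G) is the quotient by them. -/
lemma sub_toMonomial_toCochain_mem (z : MonomialCochain V(G) β) :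
    z - toMonomial G (toCochain G z) ∈ relations G := by
  refine map_mem_of_forall_monomial (LinearMap.id - toMonomial G ∘ₗ toCochain G) _ ?_ z
  intro s M
  simp only [LinearMap.sub_apply, LinearMap.comp_apply, LinearMap.id_apply]
  by_cases hs : (s : Set β) ⊆ E(G)
  · have h := monomial_sub_mem_relations s M
    by_cases hM : Set.InjOn (component G s) (M : Set V(G))
    · rw [toCochain_of_pos hs hM, toMonomial_single, marks_markedState]
      rwa [if_pos hM] at h
    · rw [toCochain_of_neg (fun h => hM h.2), map_zero]
      rwa [if_neg hM] at h
  · rw [toCochain_of_neg (fun h => hs h.1), map_zero, sub_zero]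
    exact monomial_mem_relations hs M

/-- The endomorphism of the chromatic complex induced by an endomorphism of the monomial
cochains. -/
def descend (φ : MonomialCochain V(G) β →ₗ[ℤ] MonomialCochain V(G) β) : Cochain G →ₗ[ℤ] Cochain G :=
  toCochain G ∘ₗ φ ∘ₗ toMonomial G

/-- `descend` is defined through chosen roots. For maps that respect the relations the choice is
immaterial, so identities between such maps pass from monomials to C(G). -/
lemma descend_toCochain {φ : MonomialCochain V(G) β →ₗ[ℤ] MonomialCochain V(G) β}
    (hφ : RespectsRelations G φ) (z : MonomialCochain V(G) β) :
    descend φ (toCochain G z) = toCochain G (φ z) := by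
  have := relations_le_ker_toCochain (hφ _ (sub_toMonomial_toCochain_mem z))
  rw [LinearMap.mem_ker, map_sub, map_sub, sub_eq_zero] at this
  exact this.symm

end Presentation

/-! ### Homotopies on monomial cochains -/

/-! ### Bidegrees of operators -/

section Bidegree

variable {V β : Type*}

/-- The span of the monomials `e_s x_M` with `#s = i` and `#M = j`. -/
def monomialPart (V β : Type*) (i j : ℤ) : Submodule ℤ (MonomialCochain V β) :=
  monomialSpan fun s M => (s.card : ℤ) = i ∧ (M.card : ℤ) = j

/-- The linear map `φ` has bidegree `(p, q)`. -/
def HasBidegree (φ : MonomialCochain V β →ₗ[ℤ] MonomialCochain V β) (p q : ℤ) : Prop :=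
  ∀ i j, ∀ z ∈ monomialPart V β i j, φ z ∈ monomialPart V β (i + p) (j + q)

variable {φ ψ : MonomialCochain V β →ₗ[ℤ] MonomialCochain V β} {p q p' q' : ℤ}

lemma HasBidegree.of_monomial
    (h : ∀ s M, φ (monomial s M) ∈ monomialPart V β (s.card + p) (M.card + q)) :
    HasBidegree φ p q := by
  intro i j z hz
  refine map_mem_of_mem_monomialSpan φ _ ?_ hz
  rintro s M ⟨rfl, rfl⟩
  exact h s M

lemma HasBidegree.add (hφ : HasBidegree φ p q) (hψ : HasBidegree ψ p q) :
    HasBidegree (φ + ψ) p q :=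
  fun i j z hz => Submodule.add_mem _ (hφ i j z hz) (hψ i j z hz)

lemma HasBidegree.sub (hφ : HasBidegree φ p q) (hψ : HasBidegree ψ p q) :
    HasBidegree (φ - ψ) p q :=
  fun i j z hz => Submodule.sub_mem _ (hφ i j z hz) (hψ i j z hz)

lemma HasBidegree.zero : HasBidegree (0 : MonomialCochain V β →ₗ[ℤ] MonomialCochain V β) p q :=
  fun _ _ _ _ => Submodule.zero_mem _

lemma HasBidegree.id : HasBidegree (LinearMap.id : MonomialCochain V β →ₗ[ℤ] _) 0 0 :=
  fun i j z hz => by simpa using hz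

lemma HasBidegree.comp (hφ : HasBidegree φ p q) (hψ : HasBidegree ψ p' q') {r t : ℤ}
    (hr : p' + p = r) (ht : q' + q = t) : HasBidegree (φ ∘ₗ ψ) r t := by
  intro i j z hz
  have := hφ _ _ _ (hψ i j z hz)
  rwa [add_assoc, add_assoc, hr, ht] at this

lemma hasBidegree_edgeProj (A : Finset β → Prop) : HasBidegree (edgeProj V A) 0 0 := by
  refine .of_monomial fun s M => ?_
  by_cases h : A s
  · rw [edgeProj_of_pos h]; exact monomial_mem_span (by simp)
  · rw [edgeProj_of_neg h]; exact Submodule.zero_mem _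

lemma hasBidegree_mulVar [DecidableEq V] (v : V) : HasBidegree (mulVar β v) 0 1 := by
  refine .of_monomial fun s M => ?_
  rw [mulVar_monomial]
  split_ifs with h
  · exact Submodule.zero_mem _
  · exact monomial_mem_span (by simp [h])

lemma hasBidegree_coeffVar [DecidableEq V] (v : V) : HasBidegree (coeffVar β v) 0 (-1) := by
  refine .of_monomial fun s M => ?_
  rw [coeffVar_monomial]
  split_ifs with h
  · refine monomial_mem_span ⟨by simp, ?_⟩
    have := Finset.card_erase_add_one h
    omega
  · exact Submodule.zero_mem _

variable [LinearOrder β]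

lemma hasBidegree_mulEdge (f : β) : HasBidegree (mulEdge V f) 1 0 := by
  refine .of_monomial fun s M => ?_
  rw [mulEdge_monomial]
  split_ifs with h
  · exact Submodule.zero_mem _
  · exact Submodule.smul_mem _ _ (monomial_mem_span (by simp [h]))

lemma hasBidegree_removeEdge (f : β) : HasBidegree (removeEdge V f) (-1) 0 := by
  refine .of_monomial fun s M => ?_
  rw [removeEdge_monomial]
  split_ifs with h
  · refine Submodule.smul_mem _ _ (monomial_mem_span ⟨?_, by simp⟩)
    have := Finset.card_erase_add_one h
    omega
  · exact Submodule.zero_mem _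

end Bidegree

/-! ### Operators and conditions on the edge set -/

section EdgePredicates

variable {V β : Type*}

lemma edgeProj_of_mem {A : Finset β → Prop} {z : MonomialCochain V β}
    (hz : z ∈ monomialSpan fun s _ => A s) : edgeProj V A z = z :=
  eq_of_mem_monomialSpan (ψ := LinearMap.id) (fun _ M h => edgeProj_of_pos (A := A) h M) hz

lemma edgeProj_mem (A : Finset β → Prop) (z : MonomialCochain V β) :
    edgeProj V A z ∈ monomialSpan fun s _ => A s := by
  refine map_mem_of_forall_monomial _ _ (fun s M => ?_) z
  by_cases h : A s
  · rw [edgeProj_of_pos h]; exact monomial_mem_span h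
  · rw [edgeProj_of_neg h]; exact Submodule.zero_mem _

lemma edgeProj_monomialSpan (A B : Finset β → Prop)
    {z : MonomialCochain V β} (hz : z ∈ monomialSpan fun s _ => B s) :
    edgeProj V A z ∈ monomialSpan fun s _ => B s := by
  refine map_mem_of_mem_monomialSpan (edgeProj V A) _ (fun s M hB => ?_) hz
  by_cases h : A s
  · rw [edgeProj_of_pos h]; exact monomial_mem_span hB
  · rw [edgeProj_of_neg h]; exact Submodule.zero_mem _

lemma mulVar_monomialSpan [DecidableEq V] (A : Finset β → Prop) (v : V)
    {z : MonomialCochain V β} (hz : z ∈ monomialSpan fun s _ => A s) :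
    mulVar β v z ∈ monomialSpan fun s _ => A s := by
  refine map_mem_of_mem_monomialSpan (mulVar β v) _ (fun s M hA => ?_) hz
  rw [mulVar_monomial]
  split_ifs
  · exact Submodule.zero_mem _
  · exact monomial_mem_span hA

variable [LinearOrder β]

lemma mulEdge_monomialSpan {A B : Finset β → Prop} (f : β) (h : ∀ s, A s → B (insert f s))
    {z : MonomialCochain V β} (hz : z ∈ monomialSpan fun s _ => A s) :
    mulEdge V f z ∈ monomialSpan fun s _ => B s := by
  refine map_mem_of_mem_monomialSpan (mulEdge V f) _ (fun s M hA => ?_) hz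
  rw [mulEdge_monomial]
  split_ifs
  · exact Submodule.zero_mem _
  · exact Submodule.smul_mem _ _ (monomial_mem_span (h s hA))

lemma removeEdge_monomialSpan {A B : Finset β → Prop} (f : β) (h : ∀ s, A s → B (s.erase f))
    {z : MonomialCochain V β} (hz : z ∈ monomialSpan fun s _ => A s) :
    removeEdge V f z ∈ monomialSpan fun s _ => B s := by
  refine map_mem_of_mem_monomialSpan (removeEdge V f) _ (fun s M hA => ?_) hz
  rw [removeEdge_monomial]
  split_ifs
  · exact Submodule.smul_mem _ _ (monomial_mem_span (h s hA))
  · exact Submodule.zero_mem _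

lemma mulEdge_mem (f : β) (z : MonomialCochain V β) :
    mulEdge V f z ∈ monomialSpan fun s _ => f ∈ s := by
  refine map_mem_of_forall_monomial _ _ (fun s M => ?_) z
  rw [mulEdge_monomial]
  split_ifs
  · exact Submodule.zero_mem _
  · exact Submodule.smul_mem _ _ (monomial_mem_span (Finset.mem_insert_self _ _))

end EdgePredicates

/-! ### Homotopies that remove an edge -/

section Homotopies

open scoped Classical

variable {α β : Type*} [LinearOrder β] {G : Graph α β}

/-- The removal of the edge `f` with ends `u` and `v`, followed by multiplication by `x_u + x_v`:
the comultiplication of `ℤ[x]/(x²)`. -/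
def comulEdge (G : Graph α β) (f : β) (u v : V(G)) :
    MonomialCochain V(G) β →ₗ[ℤ] MonomialCochain V(G) β :=
  (mulVar β u + mulVar β v) ∘ₗ removeEdge V(G) f

lemma comulEdge_apply (f : β) (u v : V(G)) (z : MonomialCochain V(G) β) :
    comulEdge G f u v z = mulVar β u (removeEdge V(G) f z) + mulVar β v (removeEdge V(G) f z) :=
  rfl

lemma hasBidegree_comulEdge (f : β) (u v : V(G)) : HasBidegree (comulEdge G f u v) (-1) 1 :=
  ((hasBidegree_mulVar u).add (hasBidegree_mulVar v)).comp (hasBidegree_removeEdge f)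
    (by norm_num) (by norm_num)

lemma removeEdge_monomial_mem_relations {f : β} (hf : f ∈ E(G)) {s : Finset β}
    (hs : ¬ (s : Set β) ⊆ E(G)) (M : Finset V(G)) :
    removeEdge V(G) f (monomial s M) ∈ relations G := by
  rw [removeEdge_monomial]
  split_ifs with h
  · refine Submodule.smul_mem _ _ (monomial_mem_relations (fun h' => hs fun x hx => ?_) _)
    by_cases hxf : x = f
    · rwa [hxf]
    · exact h' (by simpa [hxf] using hx)
  · exact Submodule.zero_mem _

/-- Removing f may separate u from v and so lose the relation x_u = x_v. The factor x_u + x_v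
restores it, because (x_u + x_v)(x_u - x_v) = x_u² - x_v² = 0. Relations that come from other edges
survive the removal. -/
lemma comulEdge_relations {f : β} {u v : V(G)} (hf : G.IsLink f u v) :
    RespectsRelations G (comulEdge G f u v) := by
  refine respectsRelations_of (fun s M hs => ?_) fun s M g hg p r h => ?_
  · have := removeEdge_monomial_mem_relations hf.edge_mem hs M
    exact Submodule.add_mem _ (mulVar_relations u _ this) (mulVar_relations v _ this)
  · by_cases hfs : f ∈ s
    swap
    · rw [map_sub, comulEdge_apply, comulEdge_apply, removeEdge_mulVar, removeEdge_mulVar,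
        removeEdge_monomial, if_neg hfs]
      simp
    by_cases hgf : g = f
    · subst hgf
      have key : comulEdge G g u v (mulVar β u (monomial s M) - mulVar β v (monomial s M)) = 0 := by
        simp only [map_sub, comulEdge_apply, removeEdge_mulVar, mulVar_mulVar_self]
        rw [mulVar_comm v u]
        abel
      rcases hf.eq_and_eq_or_eq_and_eq h with ⟨h1, h2⟩ | ⟨h1, h2⟩
      · obtain rfl := Subtype.ext h1
        obtain rfl := Subtype.ext h2
        rw [key]
        exact Submodule.zero_mem _
      · obtain rfl := Subtype.ext h1
        obtain rfl := Subtype.ext h2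
        rw [← neg_sub, map_neg, key, neg_zero]
        exact Submodule.zero_mem _
    · have : removeEdge V(G) f (mulVar β p (monomial s M) - mulVar β r (monomial s M)) ∈
          relations G := by
        rw [map_sub, removeEdge_mulVar, removeEdge_mulVar, removeEdge_monomial, if_pos hfs,
          map_smul, map_smul, ← smul_sub]
        exact Submodule.smul_mem _ _ (mulVar_sub_mem_relations (by simp [hgf, hg]) h _)
      exact Submodule.add_mem _ (mulVar_relations u _ this) (mulVar_relations v _ this)

/-- If `e`, `f`, `g` form a triangle, then the removal of `g` from the edge sets that contain `e`
and `f` respects the relations. -/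
lemma removeEdge_comp_edgeProj_relations {e f g : β} {a b t : V(G)} (he : G.IsLink e a b)
    (hf : G.IsLink f t b) (hg : G.IsLink g t a) (hge : g ≠ e) (hgf : g ≠ f) :
    RespectsRelations G (removeEdge V(G) g ∘ₗ edgeProj V(G) fun s => e ∈ s ∧ f ∈ s) := by
  have key : ∀ (s : Finset β) (u : V(G)) (M : Finset V(G)), e ∈ s ∧ f ∈ s →
      edgeProj V(G) (fun s => e ∈ s ∧ f ∈ s) (mulVar β u (monomial s M)) =
        mulVar β u (monomial s M) := fun s u M hs =>
    edgeProj_of_mem (mulVar_monomialSpan (fun s => e ∈ s ∧ f ∈ s) _ (monomial_mem_span hs))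
  have key' : ∀ (s : Finset β) (u : V(G)) (M : Finset V(G)), ¬ (e ∈ s ∧ f ∈ s) →
      edgeProj V(G) (fun s => e ∈ s ∧ f ∈ s) (mulVar β u (monomial s M)) = 0 := by
    intro s u M hs
    rw [mulVar_monomial]
    split_ifs
    · simp
    · exact edgeProj_of_neg hs _
  refine respectsRelations_of (fun s M hs => ?_) fun s M h hh u v huv => ?_
  · rw [LinearMap.comp_apply]
    by_cases hef : e ∈ s ∧ f ∈ s
    · rw [edgeProj_of_pos (A := fun s => e ∈ s ∧ f ∈ s) hef]
      exact removeEdge_monomial_mem_relations hg.edge_mem hs M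
    · rw [edgeProj_of_neg (A := fun s => e ∈ s ∧ f ∈ s) hef, map_zero]
      exact Submodule.zero_mem _
  · rw [LinearMap.comp_apply, map_sub]
    by_cases hef : e ∈ s ∧ f ∈ s
    swap
    · rw [key' s u M hef, key' s v M hef, sub_zero, map_zero]
      exact Submodule.zero_mem _
    rw [key s u M hef, key s v M hef, map_sub, removeEdge_mulVar, removeEdge_mulVar,
      removeEdge_monomial]
    split_ifs with hgs
    swap
    · simp
    rw [map_smul, map_smul, ← smul_sub]
    refine Submodule.smul_mem _ _ (mulVar_sub_mem_relations_of_component ?_ _)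
    by_cases hhg : h = g
    -- The relation comes from the removed edge itself; its ends t and a remain connected through b
    -- by f and e.
    · have h1 : component G (s.erase g) t = component G (s.erase g) b :=
        Quot.sound ⟨f, by simp [hgf.symm, hef.2], hf⟩
      have h2 : component G (s.erase g) a = component G (s.erase g) b :=
        Quot.sound ⟨e, by simp [hge.symm, hef.1], he⟩
      subst hhg
      rcases hg.eq_and_eq_or_eq_and_eq huv with ⟨h3, h4⟩ | ⟨h3, h4⟩
      · obtain rfl := Subtype.ext h3
        obtain rfl := Subtype.ext h4
        rw [h1, h2]
      · obtain rfl := Subtype.ext h3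
        obtain rfl := Subtype.ext h4
        rw [h1, h2]
    · exact Quot.sound ⟨h, by simp [hhg, hh], huv⟩

variable [Fintype β]

lemma monomialDifferential_mulVar (v : V(G)) (z : MonomialCochain V(G) β) :
    monomialDifferential G (mulVar β v z) = mulVar β v (monomialDifferential G z) := by
  simp only [monomialDifferential_apply, map_sum]
  refine Finset.sum_congr rfl fun f _ => ?_
  split_ifs
  · exact mulEdge_mulVar f v z
  · simp

/-- Only the summand e_f of the differential fails to anticommute with the removal of f. On
monomials this alone is a contraction, but the removal of f need not respect the relations;
`comulEdge` and `exists_contraction` are two ways around this. -/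
lemma monomialDifferential_removeEdge {f : β} (hf : f ∈ E(G)) (z : MonomialCochain V(G) β) :
    monomialDifferential G (removeEdge V(G) f z) + removeEdge V(G) f (monomialDifferential G z) =
      z := by
  simp only [monomialDifferential_apply, map_sum, ← Finset.sum_add_distrib]
  rw [Finset.sum_eq_single f]
  · rw [if_pos hf, if_pos hf, add_comm]
    exact removeEdge_mulEdge_self f z
  · intro g _ hg
    split_ifs
    · rw [add_comm]
      exact removeEdge_mulEdge_of_ne hg.symm z
    · simp
  · simp

lemma monomialDifferential_comulEdge {f : β} (hf : f ∈ E(G)) (u v : V(G))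
    (z : MonomialCochain V(G) β) :
    monomialDifferential G (comulEdge G f u v z) + comulEdge G f u v (monomialDifferential G z) =
      mulVar β u z + mulVar β v z := by
  have h := monomialDifferential_removeEdge hf z
  rw [comulEdge_apply, comulEdge_apply, map_add, monomialDifferential_mulVar,
    monomialDifferential_mulVar, add_add_add_comm, ← map_add, ← map_add, h]

lemma monomialDifferential_monomialSpan {A : Finset β → Prop} (h : ∀ f s, A s → A (insert f s))
    {z : MonomialCochain V(G) β} (hz : z ∈ monomialSpan fun s _ => A s) :
    monomialDifferential G z ∈ monomialSpan fun s _ => A s := by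
  rw [monomialDifferential_apply]
  refine Submodule.sum_mem _ fun f _ => ?_
  split_ifs
  · exact mulEdge_monomialSpan f (h f) hz
  · exact Submodule.zero_mem _

lemma hasBidegree_monomialDifferential : HasBidegree (monomialDifferential G) 1 0 := by
  intro i j z hz
  rw [monomialDifferential_apply]
  refine Submodule.sum_mem _ fun f _ => ?_
  split_ifs
  · exact hasBidegree_mulEdge f i j z hz
  · exact Submodule.zero_mem _

/-- The monomials whose edge set contains `e` and an edge of `F` span a contractible complex, if
every edge of `F` forms a triangle with `e` and an edge outside `F`. -/
lemma exists_contraction {e : β} {a b : V(G)} (he : G.IsLink e a b) (F : Finset β)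
    (hF : ∀ f ∈ F, ∃ (t : V(G)) (g : β), G.IsLink f t b ∧ G.IsLink g t a ∧ g ≠ e ∧ g ∉ F) :
    ∃ κ : MonomialCochain V(G) β →ₗ[ℤ] MonomialCochain V(G) β,
      RespectsRelations G κ ∧ HasBidegree κ (-1) 0 ∧
      (∀ z, κ z ∈ monomialSpan fun s _ => e ∈ s) ∧
      ∀ z ∈ monomialSpan (fun s _ => e ∈ s ∧ ∃ f ∈ F, f ∈ s),
        monomialDifferential G (κ z) + κ (monomialDifferential G z) = z := by
  induction F using Finset.induction_on with
  | empty =>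
    refine ⟨0, fun _ _ => Submodule.zero_mem _, .zero, fun _ => Submodule.zero_mem _, fun z hz => ?_⟩
    have := eq_of_mem_monomialSpan (φ := LinearMap.id) (ψ := 0) (fun s M h => by simp at h) hz
    simpa using this.symm
  | insert f F hfF ih =>
    obtain ⟨κ, hκr, hκd, hκe, hκ⟩ := ih fun f' hf' => by
      obtain ⟨t, g, h1, h2, h3, h4⟩ := hF f' (Finset.mem_insert_of_mem hf')
      exact ⟨t, g, h1, h2, h3, fun h => h4 (Finset.mem_insert_of_mem h)⟩
    obtain ⟨t, g, hft, hgt, hge, hgF⟩ := hF f (Finset.mem_insert_self _ _)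
    rw [Finset.mem_insert, not_or] at hgF
    obtain ⟨hgf, hgF⟩ := hgF
    -- This contracts the part where e and f are both present. The induction hypothesis treats the
    -- rest through `A`, a chain map homotopic to the identity.
    let κ' := removeEdge V(G) g ∘ₗ edgeProj V(G) fun s => e ∈ s ∧ f ∈ s
    have hκ'r : RespectsRelations G κ' :=
      removeEdge_comp_edgeProj_relations he hft hgt hge hgf
    have hκ'd : HasBidegree κ' (-1) 0 :=
      (hasBidegree_removeEdge g).comp (hasBidegree_edgeProj _) (by norm_num) (by norm_num)
    have hκ'e : ∀ z, κ' z ∈ monomialSpan fun s _ => e ∈ s := fun z =>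
      removeEdge_monomialSpan (A := fun s => e ∈ s ∧ f ∈ s) (B := fun s => e ∈ s) g
        (fun s hs => Finset.mem_erase.2 ⟨hge.symm, hs.1⟩) (edgeProj_mem _ z)
    let D := monomialDifferential G
    let A := LinearMap.id - (D ∘ₗ κ' + κ' ∘ₗ D)
    have hAapp : ∀ z, A z = z - (D (κ' z) + κ' (D z)) := fun z => rfl
    have hDD : ∀ z, D (D z) = 0 := monomialDifferential_comp_self
    have hAD : ∀ z, A (D z) = D (A z) := by
      intro z
      simp only [hAapp, map_sub, map_add, hDD, map_zero]
      abel
    have hA : monomialSpan (fun s _ => e ∈ s ∧ ∃ f' ∈ insert f F, f' ∈ s) ≤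
        (monomialSpan (fun s _ => e ∈ s ∧ ∃ f' ∈ F, f' ∈ s)).comap A := by
      refine monomialSpan_le_comap A _ fun s M hs => ?_
      rw [hAapp]
      by_cases hfs : f ∈ s
      -- The sets containing e and f are closed under adding edges, so the projection does nothing
      -- here; `κ'` is an honest contraction and `A` vanishes.
      · have h1 : monomial s M ∈ monomialSpan (fun (s : Finset β) (_ : Finset V(G)) =>
          e ∈ s ∧ f ∈ s) := monomial_mem_span ⟨hs.1, hfs⟩
        have h2 := monomialDifferential_monomialSpan (G := G) (A := fun s => e ∈ s ∧ f ∈ s)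
          (fun _ _ h => ⟨Finset.mem_insert_of_mem h.1, Finset.mem_insert_of_mem h.2⟩) h1
        simp only [κ', LinearMap.comp_apply]
        rw [edgeProj_of_mem h1, edgeProj_of_mem h2, monomialDifferential_removeEdge hgt.edge_mem,
          sub_self]
        exact Submodule.zero_mem _
      · have hs' : e ∈ s ∧ ∃ f' ∈ F, f' ∈ s := by
          obtain ⟨h1, f', hf', h2⟩ := hs
          refine ⟨h1, f', (Finset.mem_insert.1 hf').resolve_left ?_, h2⟩
          rintro rfl
          exact hfs h2
        have h1 : monomial s M ∈ monomialSpan (fun (s : Finset β) (_ : Finset V(G)) =>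
          e ∈ s ∧ ∃ f' ∈ F, f' ∈ s) := monomial_mem_span hs'
        have h2 : κ' (monomial s M) = 0 := by
          simp only [κ', LinearMap.comp_apply]
          rw [edgeProj_of_neg (A := fun s => e ∈ s ∧ f ∈ s) (fun h => hfs h.2), map_zero]
        rw [h2, map_zero, zero_add]
        -- For f ∉ s the monomial is killed by `κ'`, so `A` subtracts only κ' D. This keeps e and
        -- the edge of F, because g ≠ e and g ∉ F.
        refine Submodule.sub_mem _ h1 ?_
        refine removeEdge_monomialSpan (A := fun s => e ∈ s ∧ ∃ f' ∈ F, f' ∈ s)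
          (B := fun s => e ∈ s ∧ ∃ f' ∈ F, f' ∈ s) g ?_ (edgeProj_monomialSpan _ _
          (monomialDifferential_monomialSpan (A := fun s => e ∈ s ∧ ∃ f' ∈ F, f' ∈ s) ?_ h1))
        · rintro s ⟨h3, f', hf', h4⟩
          refine ⟨by simp [hge.symm, h3], f', hf', ?_⟩
          have : f' ≠ g := by rintro rfl; exact hgF hf'
          simp [this, h4]
        · rintro k s ⟨h3, f', hf', h4⟩
          exact ⟨Finset.mem_insert_of_mem h3, f', hf', Finset.mem_insert_of_mem h4⟩
    -- As `A` commutes with D and has image in the smaller span, κA contributes `A` to the homotopy,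
    -- and `A` is the identity minus the contribution of `κ'`.
    refine ⟨κ' + κ ∘ₗ A, ?_, ?_, fun z => ?_, fun z hz => ?_⟩
    · have hDr : RespectsRelations G D := monomialDifferential_relations
      exact hκ'r.add (hκr.comp (.sub .id ((hDr.comp hκ'r).add (hκ'r.comp hDr))))
    · refine hκ'd.add (hκd.comp (p' := 0) (q' := 0) (.sub .id (.add ?_ ?_)) (by simp) (by simp))
      · exact hasBidegree_monomialDifferential.comp hκ'd (by norm_num) (by norm_num)
      · exact hκ'd.comp hasBidegree_monomialDifferential (by norm_num) (by norm_num)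
    · exact Submodule.add_mem _ (hκ'e z) (hκe _)
    · have h1 := hκ _ (hA hz)
      change D (κ (A z)) + κ (D (A z)) = A z at h1
      change D (κ' z + κ (A z)) + (κ' (D z) + κ (A (D z))) = z
      rw [hAD, map_add, add_add_add_comm, h1, hAapp]
      abel

end Homotopies

/-! ### Adding e at an isolated vertex -/

section Merge

open scoped Classical

variable {α β : Type*} [LinearOrder β] {G : Graph α β}

/-- On the monomials in which the vertex `b` is isolated: take the coefficient of `x_b` and add the
edge `e`. -/
def mergeEdge (G : Graph α β) (e : β) (b : V(G)) :
    MonomialCochain V(G) β →ₗ[ℤ] MonomialCochain V(G) β :=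
  mulEdge V(G) e ∘ₗ coeffVar β b ∘ₗ edgeProj V(G) fun s => ∀ f ∈ s, ¬ G.Inc f b

lemma mergeEdge_of_pos {e : β} {b : V(G)} {s : Finset β} (h : ∀ f ∈ s, ¬ G.Inc f b)
    {z : MonomialCochain V(G) β} (hz : z ∈ monomialSpan fun t _ => t = s) :
    mergeEdge G e b z = mulEdge V(G) e (coeffVar β b z) := by
  have : edgeProj V(G) (fun s => ∀ f ∈ s, ¬ G.Inc f b) z = z :=
    eq_of_mem_monomialSpan (ψ := LinearMap.id)
      (fun t M ht => edgeProj_of_pos (A := fun s => ∀ f ∈ s, ¬ G.Inc f b) (ht ▸ h) M) hz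
  simp only [mergeEdge, LinearMap.comp_apply, this]

lemma mergeEdge_of_mem {e f : β} {b : V(G)} (hf : G.Inc f b) {z : MonomialCochain V(G) β}
    (hz : z ∈ monomialSpan fun s _ => f ∈ s) : mergeEdge G e b z = 0 := by
  have : edgeProj V(G) (fun s => ∀ f ∈ s, ¬ G.Inc f b) z = 0 :=
    eq_of_mem_monomialSpan (ψ := 0)
      (fun t M ht => edgeProj_of_neg (A := fun s => ∀ f ∈ s, ¬ G.Inc f b)
        (fun h => h f ht hf) M) hz
  simp only [mergeEdge, LinearMap.comp_apply, this, map_zero]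

lemma mergeEdge_mem (e : β) (b : V(G)) (z : MonomialCochain V(G) β) :
    mergeEdge G e b z ∈ monomialSpan fun s _ => e ∈ s :=
  mulEdge_mem _ _

lemma hasBidegree_mergeEdge (e : β) (b : V(G)) : HasBidegree (mergeEdge G e b) 1 (-1) :=
  (hasBidegree_mulEdge e).comp ((hasBidegree_coeffVar b).comp (hasBidegree_edgeProj _) rfl rfl)
    (by norm_num) (by norm_num)

/-- If no edge of s meets b, no relation on e_s that identifies two variables involves x_b, so
taking its coefficient is well defined. -/
lemma mergeEdge_relations (e : β) (b : V(G)) : RespectsRelations G (mergeEdge G e b) := by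
  refine (mulEdge_relations e).comp (respectsRelations_of (fun s M hs => ?_)
    fun s M f hf u v h => ?_)
  · rw [LinearMap.comp_apply]
    by_cases h : ∀ f ∈ s, ¬ G.Inc f b
    · rw [edgeProj_of_pos (A := fun s => ∀ f ∈ s, ¬ G.Inc f b) h, coeffVar_monomial]
      split_ifs
      · exact monomial_mem_relations hs _
      · exact Submodule.zero_mem _
    · rw [edgeProj_of_neg (A := fun s => ∀ f ∈ s, ¬ G.Inc f b) h, map_zero]
      exact Submodule.zero_mem _
  · rw [LinearMap.comp_apply]
    by_cases hs : ∀ f ∈ s, ¬ G.Inc f b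
    · have hu : b ≠ u := by rintro rfl; exact hs f hf ⟨_, h⟩
      have hv : b ≠ v := by rintro rfl; exact hs f hf ⟨_, h.symm⟩
      have hm : ∀ w : V(G), mulVar β w (monomial s M) ∈
          monomialSpan fun s _ => ∀ f ∈ s, ¬ G.Inc f b := fun w =>
        mulVar_monomialSpan (fun s => ∀ f ∈ s, ¬ G.Inc f b) w (monomial_mem_span hs)
      rw [map_sub, edgeProj_of_mem (hm u), edgeProj_of_mem (hm v), map_sub,
        coeffVar_mulVar_of_ne hu, coeffVar_mulVar_of_ne hv, coeffVar_monomial]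
      split_ifs
      · exact mulVar_sub_mem_relations hf h _
      · simp
    · have hm : ∀ w : V(G), edgeProj V(G) (fun s => ∀ f ∈ s, ¬ G.Inc f b)
          (mulVar β w (monomial s M)) = 0 := by
        intro w
        rw [mulVar_monomial]
        split_ifs
        · simp
        · exact edgeProj_of_neg hs _
      rw [map_sub, hm, hm, sub_zero, map_zero]
      exact Submodule.zero_mem _

variable [Fintype β]

/-- The edges at `b` other than `e`. -/
def otherEdges (G : Graph α β) (e : β) (b : V(G)) : Finset β :=
  Finset.univ.filter fun f => f ≠ e ∧ G.Inc f b

lemma mem_otherEdges {e f : β} {b : V(G)} : f ∈ otherEdges G e b ↔ f ≠ e ∧ G.Inc f b := by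
  simp [otherEdges]

/-- The span of the monomials whose edge set contains `e` and another edge at `b`. -/
def doubleSpan (G : Graph α β) (e : β) (b : V(G)) : Submodule ℤ (MonomialCochain V(G) β) :=
  monomialSpan fun s _ => e ∈ s ∧ ∃ f ∈ otherEdges G e b, f ∈ s

lemma mulEdge_mem_doubleSpan {e f : β} {b : V(G)} (hf : f ∈ otherEdges G e b)
    {z : MonomialCochain V(G) β} (hz : z ∈ monomialSpan fun s _ => f ∈ s) :
    mulEdge V(G) e z ∈ doubleSpan G e b :=
  mulEdge_monomialSpan (A := fun s => f ∈ s)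
    (B := fun s => e ∈ s ∧ ∃ f ∈ otherEdges G e b, f ∈ s) e
    (fun _ hs => ⟨Finset.mem_insert_self _ _, f, hf, Finset.mem_insert_of_mem hs⟩) hz

/-- Up to `doubleSpan`, the map `mergeEdge` anticommutes with the differential. -/
lemma monomialDifferential_mergeEdge (e : β) (b : V(G)) (z : MonomialCochain V(G) β) :
    monomialDifferential G (mergeEdge G e b z) + mergeEdge G e b (monomialDifferential G z) ∈
      doubleSpan G e b := by
  refine map_mem_of_forall_monomial (monomialDifferential G ∘ₗ mergeEdge G e b +
    mergeEdge G e b ∘ₗ monomialDifferential G) _ (fun s M => ?_) z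
  simp only [LinearMap.add_apply, LinearMap.comp_apply, monomialDifferential_apply, map_sum,
    ← Finset.sum_add_distrib]
  refine Submodule.sum_mem _ fun f _ => ?_
  split_ifs with hf
  swap
  · simp
  by_cases hs : ∀ g ∈ s, ¬ G.Inc g b
  swap
  · push Not at hs
    obtain ⟨g, hg, hgb⟩ := hs
    rw [mergeEdge_of_mem hgb (monomial_mem_span hg), mergeEdge_of_mem hgb
      (mulEdge_monomialSpan (A := fun s => g ∈ s) (B := fun s => g ∈ s) f
        (fun _ h => Finset.mem_insert_of_mem h) (monomial_mem_span hg))]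
    simp
  rw [mergeEdge_of_pos hs (monomial_mem_span rfl)]
  by_cases hfb : G.Inc f b
  -- After f is added, b is no longer isolated and one term vanishes. In the other, e_f e_e is zero
  -- for f = e and otherwise contains two edges at b.
  · rw [mergeEdge_of_mem hfb (mulEdge_mem _ _), add_zero]
    by_cases hfe : f = e
    · rw [hfe, mulEdge_mulEdge_self]
      exact Submodule.zero_mem _
    · rw [mulEdge_mulEdge]
      exact Submodule.neg_mem _
        (mulEdge_mem_doubleSpan (mem_otherEdges.2 ⟨hfe, hfb⟩) (mulEdge_mem _ _))
  · rw [mergeEdge_of_pos (s := insert f s), ← mulEdge_coeffVar, mulEdge_mulEdge, neg_add_cancel]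
    · exact Submodule.zero_mem _
    · intro g hg
      rcases Finset.mem_insert.1 hg with rfl | hg
      · exact hfb
      · exact hs g hg
    · exact mulEdge_monomialSpan (A := fun t => t = s) (B := fun t => t = insert f s) f
        (fun t ht => by rw [ht]) (monomial_mem_span rfl)

/-- Up to `doubleSpan` and the relations, adding the edge `e` is the composite of multiplication by
`x_a + x_b` and `mergeEdge`. -/
lemma mulEdge_sub_mergeEdge_mem {e : β} {a b : V(G)} (he : G.IsLink e a b) (hab : a ≠ b)
    {z : MonomialCochain V(G) β} (hz : z ∈ monomialSpan fun s _ => e ∉ s) :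
    mulEdge V(G) e z - mergeEdge G e b (mulVar β a z + mulVar β b z) ∈
      doubleSpan G e b ⊔ relations G := by
  refine map_mem_of_mem_monomialSpan (mulEdge V(G) e - mergeEdge G e b ∘ₗ (mulVar β a + mulVar β b))
    _ (fun s M hes => ?_) hz
  simp only [LinearMap.sub_apply, LinearMap.comp_apply, LinearMap.add_apply]
  by_cases hs : ∀ g ∈ s, ¬ G.Inc g b
  · have hm : ∀ w : V(G), mulVar β w (monomial s M) ∈ monomialSpan fun t _ => t = s := fun w =>
      mulVar_monomialSpan (fun t => t = s) w (monomial_mem_span rfl)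
    rw [mergeEdge_of_pos hs (Submodule.add_mem _ (hm a) (hm b)), map_add,
      coeffVar_mulVar_of_ne hab.symm, coeffVar_mulVar_self, ← map_sub]
    refine Submodule.mem_sup_right ?_
    -- With z = z₀ + x_b z₁, the coefficient of x_b in (x_a + x_b) z is z₀ + x_a z₁. It differs from
    -- z by (x_b - x_a) z₁, which becomes a relation once e is present.
    have key : monomial s M - (mulVar β a (coeffVar β b (monomial s M)) +
        (monomial s M - mulVar β b (coeffVar β b (monomial s M)))) =
        - (mulVar β a (coeffVar β b (monomial s M)) - mulVar β b (coeffVar β b (monomial s M))) := by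
      abel
    rw [key, map_neg, map_sub, mulEdge_mulVar, mulEdge_mulVar, coeffVar_monomial]
    refine Submodule.neg_mem _ ?_
    split_ifs
    · rw [mulEdge_monomial, if_neg hes, map_smul, map_smul, ← smul_sub]
      exact Submodule.smul_mem _ _
        (mulVar_sub_mem_relations (Finset.mem_insert_self _ _) he _)
    · simp
  · push Not at hs
    obtain ⟨g, hg, hgb⟩ := hs
    have hm : ∀ w : V(G), mulVar β w (monomial s M) ∈ monomialSpan fun s _ => g ∈ s := fun w =>
      mulVar_monomialSpan (fun s => g ∈ s) w (monomial_mem_span hg)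
    -- When some g at b is present, `mergeEdge` gives zero and the whole term e_e z is a defect in
    -- `doubleSpan`.
    rw [mergeEdge_of_mem hgb (Submodule.add_mem _ (hm a) (hm b)), sub_zero]
    refine Submodule.mem_sup_left (mulEdge_mem_doubleSpan (mem_otherEdges.2 ⟨?_, hgb⟩)
      (monomial_mem_span hg))
    rintro rfl
    exact hes hg

/-- A null-homotopy of adding the edge `e`, from a path `b, u, p, a` of length three. -/
def pathHomotopy (G : Graph α β) (e f₁ f₂ f₃ : β) (a b u p : V(G)) :
    MonomialCochain V(G) β →ₗ[ℤ] MonomialCochain V(G) β :=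
  mergeEdge G e b ∘ₗ (comulEdge G f₁ u b + comulEdge G f₂ p a - comulEdge G f₃ u p)

/-! ### The homotopy along a path of length three -/

section PathHomotopy

variable {e f₁ f₂ f₃ : β} {a b u p : V(G)}

lemma hasBidegree_pathHomotopy : HasBidegree (pathHomotopy G e f₁ f₂ f₃ a b u p) 0 0 :=
  (hasBidegree_mergeEdge e b).comp
    (((hasBidegree_comulEdge f₁ u b).add (hasBidegree_comulEdge f₂ p a)).sub
      (hasBidegree_comulEdge f₃ u p)) (by norm_num) (by norm_num)

lemma pathHomotopy_relations (h₁ : G.IsLink f₁ u b) (h₂ : G.IsLink f₂ p a)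
    (h₃ : G.IsLink f₃ u p) : RespectsRelations G (pathHomotopy G e f₁ f₂ f₃ a b u p) :=
  (mergeEdge_relations e b).comp
    (((comulEdge_relations h₁).add (comulEdge_relations h₂)).sub (comulEdge_relations h₃))

lemma pathHomotopy_mem (z : MonomialCochain V(G) β) :
    pathHomotopy G e f₁ f₂ f₃ a b u p z ∈ monomialSpan fun s _ => e ∈ s := by
  rw [pathHomotopy, LinearMap.comp_apply]
  exact mergeEdge_mem _ _ _

lemma comulEdge_monomialSpan {f : β} (hf : f ≠ e) (v w : V(G)) {z : MonomialCochain V(G) β}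
    (hz : z ∈ monomialSpan fun s _ => e ∈ s) :
    comulEdge G f v w z ∈ monomialSpan fun s _ => e ∈ s := by
  have h : removeEdge V(G) f z ∈ monomialSpan fun s _ => e ∈ s :=
    removeEdge_monomialSpan (A := fun s => e ∈ s) (B := fun s => e ∈ s) f
      (fun s hs => Finset.mem_erase.2 ⟨hf.symm, hs⟩) hz
  rw [comulEdge_apply]
  refine Submodule.add_mem _ ?_ ?_
  · exact mulVar_monomialSpan (fun s => e ∈ s) v h
  · exact mulVar_monomialSpan (fun s => e ∈ s) w h

/-- The three removals leave e in place, so b is not isolated when `mergeEdge` is applied. -/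
lemma pathHomotopy_of_mem (he : G.IsLink e a b) (h₁ : f₁ ≠ e) (h₂ : f₂ ≠ e) (h₃ : f₃ ≠ e)
    {z : MonomialCochain V(G) β} (hz : z ∈ monomialSpan fun s _ => e ∈ s) :
    pathHomotopy G e f₁ f₂ f₃ a b u p z = 0 := by
  rw [pathHomotopy, LinearMap.comp_apply, LinearMap.sub_apply, LinearMap.add_apply]
  exact mergeEdge_of_mem he.inc_right (Submodule.sub_mem _ (Submodule.add_mem _
    (comulEdge_monomialSpan h₁ _ _ hz) (comulEdge_monomialSpan h₂ _ _ hz))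
    (comulEdge_monomialSpan h₃ _ _ hz))

/-- On edge sets without e, the projected differential is the differential of G - e. The term e_e z
left over is the obstruction to the inclusion being a chain map. -/
lemma sub_edgeProj_monomialDifferential (he : e ∈ E(G)) {z : MonomialCochain V(G) β}
    (hz : z ∈ monomialSpan fun s _ => e ∉ s) :
    monomialDifferential G z - edgeProj V(G) (fun s => e ∉ s) (monomialDifferential G z) =
      mulEdge V(G) e z := by
  rw [monomialDifferential_apply, map_sum, ← Finset.sum_sub_distrib, Finset.sum_eq_single e]
  · rw [if_pos he, sub_eq_self]
    exact eq_of_mem_monomialSpan (ψ := 0) (fun s M hs =>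
      edgeProj_of_neg (A := fun s => e ∉ s) (not_not.2 hs) M) (mulEdge_mem e z)
  · intro f _ hf
    split_ifs
    · rw [edgeProj_of_mem, sub_self]
      exact mulEdge_monomialSpan (A := fun s => e ∉ s) (B := fun s => e ∉ s) f
        (fun s hs => by simp [hf.symm, hs]) hz
    · simp
  · simp

lemma pathHomotopy_edgeProj (he : G.IsLink e a b) (h₁ : f₁ ≠ e) (h₂ : f₂ ≠ e) (h₃ : f₃ ≠ e)
    (z : MonomialCochain V(G) β) :
    pathHomotopy G e f₁ f₂ f₃ a b u p (edgeProj V(G) (fun s => e ∉ s) z) =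
      pathHomotopy G e f₁ f₂ f₃ a b u p z := by
  suffices h : pathHomotopy G e f₁ f₂ f₃ a b u p ∘ₗ edgeProj V(G) (fun s => e ∉ s) =
      pathHomotopy G e f₁ f₂ f₃ a b u p from LinearMap.congr_fun h z
  refine monomial_ext fun s M => ?_
  rw [LinearMap.comp_apply]
  by_cases hs : e ∈ s
  · rw [edgeProj_of_neg (A := fun s => e ∉ s) (not_not.2 hs), map_zero,
      pathHomotopy_of_mem he h₁ h₂ h₃ (monomial_mem_span hs)]
  · rw [edgeProj_of_pos (A := fun s => e ∉ s) hs]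

/-- Let M be `mergeEdge`, H the combination of removals and W = MH. Modulo `doubleSpan`, M
anticommutes with D, so DW - WD becomes -M(DH + HD) = -M(x_a + x_b). This cancels the obstruction
e_e z by `mulEdge_sub_mergeEdge_mem`. -/
lemma pathHomotopy_defect_mem (he : G.IsLink e a b) (hab : a ≠ b) (h₁ : G.IsLink f₁ u b)
    (h₂ : G.IsLink f₂ p a) (h₃ : G.IsLink f₃ u p) (h₁e : f₁ ≠ e) (h₂e : f₂ ≠ e) (h₃e : f₃ ≠ e)
    {z : MonomialCochain V(G) β} (hz : z ∈ monomialSpan fun s _ => e ∉ s) :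
    monomialDifferential G (z + pathHomotopy G e f₁ f₂ f₃ a b u p z) -
      (edgeProj V(G) (fun s => e ∉ s) (monomialDifferential G z) +
        pathHomotopy G e f₁ f₂ f₃ a b u p
          (edgeProj V(G) (fun s => e ∉ s) (monomialDifferential G z))) ∈
      doubleSpan G e b ⊔ relations G := by
  set H := comulEdge G f₁ u b + comulEdge G f₂ p a - comulEdge G f₃ u p with hH
  -- The signs +, +, - in H make the path telescope: (x_u + x_b) + (x_p + x_a) - (x_u + x_p) = x_a +
  -- x_b.
  have hdH : monomialDifferential G (H z) + H (monomialDifferential G z) =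
      mulVar β a z + mulVar β b z := by
    have e1 := monomialDifferential_comulEdge h₁.edge_mem u b z
    have e2 := monomialDifferential_comulEdge h₂.edge_mem p a z
    have e3 := monomialDifferential_comulEdge h₃.edge_mem u p z
    simp only [hH, LinearMap.sub_apply, LinearMap.add_apply, map_sub, map_add]
    rw [show ∀ A B C A' B' C' : MonomialCochain V(G) β, A + B - C + (A' + B' - C') =
      (A + A') + (B + B') - (C + C') from fun _ _ _ _ _ _ => by abel, e1, e2, e3]
    abel
  have hW : ∀ y, pathHomotopy G e f₁ f₂ f₃ a b u p y = mergeEdge G e b (H y) := fun y => rfl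
  rw [pathHomotopy_edgeProj he h₁e h₂e h₃e, map_add, hW, hW]
  have e1 := sub_edgeProj_monomialDifferential he.edge_mem hz
  have e2 := mulEdge_sub_mergeEdge_mem he hab hz
  have e3 := monomialDifferential_mergeEdge e b (H z)
  rw [← e1, ← hdH, map_add] at e2
  have := Submodule.add_mem _ (Submodule.mem_sup_left (T := relations G) e3) e2
  convert this using 1
  abel

end PathHomotopy

end Merge

/-! ### The section of `β` -/

section Extension

variable {α β : Type*} [LinearOrder β] {G : Graph α β} {e : β}

/-- An enhanced state of `G - e` as an enhanced state of `G`. -/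
def extendState (S : EnhancedState (deletion G e)) : EnhancedState G where
  edges := S.edges
  edges_subset := by
    intro f hf
    have := S.edges_subset hf
    simp only [Graph.edgeSet_deleteEdges] at this
    exact this.1
  colour v := S.colour ⟨v, by simp⟩
  colour_eq := by
    rintro u v ⟨f, hf, h⟩
    refine S.colour_eq _ _ ⟨f, hf, ?_⟩
    have := S.edges_subset hf
    simp only [Graph.edgeSet_deleteEdges] at this
    simp only [Graph.deleteEdges_isLink]
    exact ⟨h, this.2⟩

lemma notMem_edges_deletion (S : EnhancedState (deletion G e)) : e ∉ S.edges := by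
  intro h
  have := S.edges_subset h
  simp at this

lemma restrictState_extendState (S : EnhancedState (deletion G e)) :
    restrictState (extendState S) (notMem_edges_deletion S) = S :=
  rfl

lemma extendState_restrictState (S : EnhancedState G) (hS : e ∉ S.edges) :
    extendState (restrictState S hS) = S :=
  rfl

/-- The inclusion of the cochains of `G - e` into those of `G`. -/
def extendCochain (G : Graph α β) (e : β) : Cochain (deletion G e) →ₗ[ℤ] Cochain G :=
  Finsupp.linearCombination ℤ fun S => Finsupp.single (extendState S) 1

lemma extendCochain_single (S : EnhancedState (deletion G e)) :
    extendCochain G e (Finsupp.single S 1) = Finsupp.single (extendState S) 1 := by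
  simp [extendCochain]

lemma beta_extendCochain (y : Cochain (deletion G e)) : beta G e (extendCochain G e y) = y := by
  suffices h : beta G e ∘ₗ extendCochain G e = LinearMap.id from LinearMap.congr_fun h y
  refine Finsupp.lhom_ext' fun S => LinearMap.ext_ring ?_
  simp only [LinearMap.comp_apply, Finsupp.lsingle_apply, extendCochain_single, beta_single]
  rw [dif_neg (show e ∉ (extendState S).edges from notMem_edges_deletion S),
    restrictState_extendState]
  rfl

/-- This expresses G - e inside the monomials of G, so that no second monomial model is needed. -/
lemma extendCochain_beta_toCochain (z : MonomialCochain V(G) β) :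
    extendCochain G e (beta G e (toCochain G z)) =
      toCochain G (edgeProj V(G) (fun s => e ∉ s) z) := by
  suffices h : extendCochain G e ∘ₗ beta G e ∘ₗ toCochain G =
    toCochain G ∘ₗ edgeProj V(G) (fun s => e ∉ s) from LinearMap.congr_fun h z
  refine monomial_ext fun s M => ?_
  simp only [LinearMap.comp_apply]
  by_cases h : (s : Set β) ⊆ E(G) ∧ Set.InjOn (component G s) (M : Set V(G))
  · rw [toCochain_of_pos h.1 h.2, beta_single]
    by_cases hs : e ∈ s
    · rw [edgeProj_of_neg (A := fun s => e ∉ s) (not_not.2 hs),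
        dif_pos (show e ∈ (markedState G s h.1 M).edges from hs), map_zero, map_zero]
    · rw [edgeProj_of_pos (A := fun s => e ∉ s) hs, toCochain_of_pos h.1 h.2,
        dif_neg (show e ∉ (markedState G s h.1 M).edges from hs), extendCochain_single,
        extendState_restrictState]
  · rw [toCochain_of_neg h, map_zero, map_zero]
    by_cases hs : e ∈ s
    · rw [edgeProj_of_neg (A := fun s => e ∉ s) (not_not.2 hs), map_zero]
    · rw [edgeProj_of_pos (A := fun s => e ∉ s) hs, toCochain_of_neg h]

lemma beta_toCochain_of_mem {z : MonomialCochain V(G) β}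
    (hz : z ∈ monomialSpan fun s _ => e ∈ s) : beta G e (toCochain G z) = 0 := by
  refine eq_of_mem_monomialSpan (φ := beta G e ∘ₗ toCochain G) (ψ := 0) (fun s M hs => ?_) hz
  rw [LinearMap.comp_apply]
  by_cases h : (s : Set β) ⊆ E(G) ∧ Set.InjOn (component G s) (M : Set V(G))
  · rw [toCochain_of_pos h.1 h.2, beta_single,
      dif_pos (show e ∈ (markedState G s h.1 M).edges from hs)]
    rfl
  · rw [toCochain_of_neg h, map_zero]
    rfl

lemma toCochain_monomialPart (i j : ℤ) {z : MonomialCochain V(G) β}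
    (hz : z ∈ monomialPart V(G) β i j) : toCochain G z ∈ bigradedPart G i j := by
  refine map_mem_of_mem_monomialSpan _ _ (fun s M hs => ?_) hz
  by_cases h : (s : Set β) ⊆ E(G) ∧ Set.InjOn (component G s) (M : Set V(G))
  · rw [toCochain_of_pos h.1 h.2]
    refine Finsupp.single_mem_supported _ _ ⟨hs.1, ?_⟩
    rw [xCount_markedState h.1 h.2]
    exact hs.2
  · rw [toCochain_of_neg h]
    exact Submodule.zero_mem _

lemma extendCochain_bigradedPart (i j : ℤ) :
    bigradedPart (deletion G e) i j ≤ (bigradedPart G i j).comap (extendCochain G e) := by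
  apply supported_le_comap
  rintro S ⟨h1, h2⟩
  rw [extendCochain_single]
  refine Finsupp.single_mem_supported _ _ ⟨h1, ?_⟩
  rw [← xCount_restrictState (extendState S) (notMem_edges_deletion S),
    restrictState_extendState]
  exact h2

variable [Finite V(G)]

lemma toMonomial_bigradedPart (i j : ℤ) {z : Cochain G} (hz : z ∈ bigradedPart G i j) :
    toMonomial G z ∈ monomialPart V(G) β i j := by
  rw [bigradedPart, Finsupp.supported_eq_span_single] at hz
  refine Submodule.span_le (p := (monomialPart V(G) β i j).comap (toMonomial G)).2 ?_ hz
  rintro _ ⟨S, hS, rfl⟩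
  change toMonomial G (Finsupp.single S 1) ∈ monomialPart V(G) β i j
  rw [toMonomial_single]
  exact monomial_mem_span ⟨hS.1, by rw [S.card_marks]; exact hS.2⟩

lemma descend_bigradedPart {φ : MonomialCochain V(G) β →ₗ[ℤ] MonomialCochain V(G) β} {p q : ℤ}
    (hφ : HasBidegree φ p q) (i j : ℤ) {z : Cochain G} (hz : z ∈ bigradedPart G i j) :
    descend φ z ∈ bigradedPart G (i + p) (j + q) :=
  toCochain_monomialPart _ _ (hφ i j _ (toMonomial_bigradedPart i j hz))

lemma toMonomial_extendCochain_mem (y : Cochain (deletion G e)) :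
    toMonomial G (extendCochain G e y) ∈ monomialSpan fun s _ => e ∉ s := by
  induction y using Finsupp.induction_linear with
  | zero => simp
  | add y y' h h' => rw [map_add, map_add]; exact Submodule.add_mem _ h h'
  | single S c =>
    rw [← mul_one c, ← smul_eq_mul, ← Finsupp.smul_single, map_smul, map_smul,
      extendCochain_single, toMonomial_single]
    exact Submodule.smul_mem _ _ (monomial_mem_span (notMem_edges_deletion S))

end Extension

/-! ### A section of β that is a chain map -/

section ChainSection

/-- A map that is a section of a chain map `β` and is a chain map up to a contractible part can be
corrected to a section which is a chain map. -/
lemma exists_chain_section {M N : Type*} [AddCommGroup M] [AddCommGroup N] {d : M →ₗ[ℤ] M}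
    {d' : N →ₗ[ℤ] N} (hd : d ∘ₗ d = 0) (hd' : d' ∘ₗ d' = 0) {b : M →ₗ[ℤ] N} {τ : N →ₗ[ℤ] M}
    {κ : M →ₗ[ℤ] M} {L : Submodule ℤ M} (hτ : ∀ y, b (τ y) = y)
    (hτL : ∀ y, d (τ y) - τ (d' y) ∈ L) (hκ : ∀ z ∈ L, d (κ z) + κ (d z) = z)
    (hbκ : ∀ z, b (κ z) = 0) :
    let σ := τ - κ ∘ₗ (d ∘ₗ τ - τ ∘ₗ d')
    σ ∘ₗ d' = d ∘ₗ σ ∧ b ∘ₗ σ = LinearMap.id := by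
  intro σ
  have hσ : ∀ y, σ y = τ y - κ (d (τ y) - τ (d' y)) := fun y => rfl
  have hdd : ∀ z, d (d z) = 0 := fun z => LinearMap.congr_fun hd z
  have hdd' : ∀ y, d' (d' y) = 0 := fun y => LinearMap.congr_fun hd' y
  constructor
  · ext y
    -- For the defect δ = dτ - τd' one has dδ = -τ-free: dδ = -dτd' = -δd'. Hence dκδ = δ - κdδ = δ
    -- + κδd', and therefore d(τ - κδ) = τd' - κδd'.
    have h := hκ _ (hτL y)
    rw [LinearMap.comp_apply, LinearMap.comp_apply, hσ, hσ]
    simp only [map_sub, hdd, hdd', map_zero, sub_zero, zero_sub, map_neg] at h ⊢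
    rw [← sub_eq_zero] at h ⊢
    rw [← h]
    abel
  · ext y
    rw [LinearMap.comp_apply, hσ, map_sub, hτ, hbκ, sub_zero]
    rfl

open scoped Classical

variable {α β : Type*} [LinearOrder β] [Fintype β] {G : Graph α β} [Finite V(G)]

/-- Let `e` be an edge with ends `a` and `b` such that every other neighbour of `b` is a neighbour
of `a`, and such that there is a path of length three from `b` to `a`. Then the chain map `β` has a
section which is a chain map. -/
theorem exists_section_beta {e f₁ f₂ f₃ : β} {a b u p : V(G)} (he : G.IsLink e a b) (hab : a ≠ b)
    (htri : ∀ (f : β) (t : V(G)), f ≠ e → G.IsLink f t b → t ≠ b ∧ ∃ g, G.IsLink g t a)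
    (h₁ : G.IsLink f₁ u b) (h₂ : G.IsLink f₂ p a) (h₃ : G.IsLink f₃ u p) (h₁e : f₁ ≠ e)
    (hp : p ≠ b) :
    ∃ σ : Cochain (deletion G e) →ₗ[ℤ] Cochain G,
      σ ∘ₗ differential (deletion G e) = differential G ∘ₗ σ ∧
      beta G e ∘ₗ σ = LinearMap.id ∧
      ∀ i j, ∀ y ∈ bigradedPart (deletion G e) i j, σ y ∈ bigradedPart G i j := by
  have hnotinc : ∀ {g : β} {v w : V(G)}, G.IsLink g v w → v ≠ b → w ≠ b → ¬ G.Inc g b := by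
    intro g v w h hv hw hb
    rcases hb.eq_or_eq_of_isLink h with h | h
    · exact hv (Subtype.ext h.symm)
    · exact hw (Subtype.ext h.symm)
  have hu : u ≠ b := (htri f₁ u h₁e h₁).1
  have h₂e : f₂ ≠ e := by rintro rfl; exact hnotinc h₂ hp hab he.inc_right
  have h₃e : f₃ ≠ e := by rintro rfl; exact hnotinc h₃ hu hp he.inc_right
  -- The third side g = ta of each triangle avoids b, so it is neither e nor one of the other edges
  -- at b, as the contraction requires.
  obtain ⟨κ, hκr, hκd, hκe, hκ⟩ := exists_contraction he (otherEdges G e b) (by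
    intro f hf
    obtain ⟨hfe, t, ht⟩ := mem_otherEdges.1 hf
    have ht' : G.IsLink f (⟨t, ht.right_mem⟩ : V(G)) b := ht.symm
    obtain ⟨htb, g, hg⟩ := htri f _ hfe ht'
    have hgb := hnotinc hg htb hab
    refine ⟨_, g, ht', hg, ?_, fun h => hgb (mem_otherEdges.1 h).2⟩
    rintro rfl
    exact hgb he.inc_right)
  set W := pathHomotopy G e f₁ f₂ f₃ a b u p with hWdef
  have hWr : RespectsRelations G W := pathHomotopy_relations h₁ h₂ h₃
  have hBr : RespectsRelations G (LinearMap.id + W) := .add .id hWr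
  let W' : MonomialCochain V(G) β →ₗ[ℤ] MonomialCochain V(G) β := LinearMap.id + W
  let B := descend W'
  let τ := B ∘ₗ extendCochain G e
  have hτapp : ∀ y, τ y = toCochain G (toMonomial G (extendCochain G e y) +
      W (toMonomial G (extendCochain G e y))) := fun y => rfl
  have hτ : ∀ y, beta G e (τ y) = y := by
    intro y
    rw [hτapp, map_add, map_add, toCochain_toMonomial, beta_extendCochain,
      beta_toCochain_of_mem (pathHomotopy_mem _), add_zero]
  have hext : ∀ y, extendCochain G e (differential (deletion G e) y) =
      toCochain G (edgeProj V(G) (fun s => e ∉ s)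
        (monomialDifferential G (toMonomial G (extendCochain G e y)))) := by
    intro y
    rw [← extendCochain_beta_toCochain, ← differential_toCochain, toCochain_toMonomial]
    have := LinearMap.congr_fun (beta_comp_differential G e) (extendCochain G e y)
    rw [LinearMap.comp_apply, LinearMap.comp_apply, beta_extendCochain] at this
    rw [this]
  -- The defect was controlled modulo `doubleSpan` and the relations; the relations disappear in
  -- C(G).
  have hτL : ∀ y, differential G (τ y) - τ (differential (deletion G e) y) ∈
      (doubleSpan G e b).map (toCochain G) := by
    intro y
    have h := pathHomotopy_defect_mem he hab h₁ h₂ h₃ h₁e h₂e h₃e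
      (toMonomial_extendCochain_mem (G := G) (e := e) y)
    rw [← hWdef] at h
    have hBd : τ (differential (deletion G e) y) = toCochain G (W'
        (edgeProj V(G) (fun s => e ∉ s)
          (monomialDifferential G (toMonomial G (extendCochain G e y))))) := by
      rw [← descend_toCochain hBr, ← hext]
      rfl
    rw [hBd, hτapp, differential_toCochain, ← map_sub]
    obtain ⟨z, hz, r, hr, hzr⟩ := Submodule.mem_sup.1 h
    refine ⟨z, hz, ?_⟩
    have hW' : ∀ x, W' x = x + W x := fun x => rfl
    rw [hW', ← hzr, map_add, LinearMap.mem_ker.1 (relations_le_ker_toCochain hr), add_zero]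
  have hκ' : ∀ z ∈ (doubleSpan G e b).map (toCochain G),
      differential G (descend κ z) + descend κ (differential G z) = z := by
    rintro _ ⟨z, hz, rfl⟩
    rw [descend_toCochain hκr, differential_toCochain, differential_toCochain,
      descend_toCochain hκr, ← map_add, hκ z hz]
  have hbκ : ∀ z, beta G e (descend κ z) = 0 := fun z => beta_toCochain_of_mem (hκe _)
  obtain ⟨h4, h5⟩ := exists_chain_section (differential_comp_differential G)
    (differential_comp_differential (deletion G e)) hτ hτL hκ' hbκ
  refine ⟨_, h4, h5, fun i j y hy => ?_⟩
  have hτg : ∀ k, ∀ y ∈ bigradedPart (deletion G e) k j, τ y ∈ bigradedPart G k j := by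
    intro k y hy
    have := descend_bigradedPart (HasBidegree.id.add (hasBidegree_pathHomotopy (G := G) (e := e)
      (f₁ := f₁) (f₂ := f₂) (f₃ := f₃) (a := a) (b := b) (u := u) (p := p))) k j
      (extendCochain_bigradedPart k j hy)
    rwa [add_zero, add_zero] at this
  refine Submodule.sub_mem _ (hτg i y hy) ?_
  -- The defect raises the number of edges by one and κ lowers it by one, so the correction
  -- preserves the bidegree.
  have h6 : differential G (τ y) - τ (differential (deletion G e) y) ∈
      bigradedPart G (i + 1) j :=
    Submodule.sub_mem _ (differential_bigradedPart G i j (hτg i y hy))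
      (hτg _ _ (differential_bigradedPart _ i j hy))
  have h7 := descend_bigradedPart hκd (i + 1) j h6
  rwa [add_zero, add_neg_cancel_right] at h7

end ChainSection

/-! ### Split exactness -/

section SplitExact

variable {M₁ M M₂ : Type*} [AddCommGroup M₁] [AddCommGroup M] [AddCommGroup M₂]
  {d₁ : M₁ →ₗ[ℤ] M₁} {d : M →ₗ[ℤ] M} {d₂ : M₂ →ₗ[ℤ] M₂}
  {P₁ Q₁ : Submodule ℤ M₁} {P Q : Submodule ℤ M} {P₂ Q₂ : Submodule ℤ M₂}

/-- A short exact sequence of complexes with a section which is a chain map induces split exact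
sequences in homology. -/
lemma isSplitExact_homologyAtMap {φ : M₁ →ₗ[ℤ] M} {ψ : M →ₗ[ℤ] M₂}
    (hφd : φ ∘ₗ d₁ = d ∘ₗ φ) (hψd : ψ ∘ₗ d = d₂ ∘ₗ ψ)
    (hφP : P₁ ≤ P.comap φ) (hφQ : Q₁ ≤ Q.comap φ) (hψP : P ≤ P₂.comap ψ) (hψQ : Q ≤ Q₂.comap ψ)
    (hinj : Function.Injective φ) (hexact : Function.Exact φ ψ)
    (hφP' : ∀ w, φ w ∈ P → w ∈ P₁) (hφQ' : ∀ w, φ w ∈ Q → w ∈ Q₁)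
    (hdP : P ≤ Q.comap d) (hdd : d ∘ₗ d = 0)
    {σ : M₂ →ₗ[ℤ] M} (hσd : σ ∘ₗ d₂ = d ∘ₗ σ) (hσ : ψ ∘ₗ σ = LinearMap.id)
    (hσP : P₂ ≤ P.comap σ) (hσQ : Q₂ ≤ Q.comap σ) :
    IsSplitExact (homologyAtMap φ hφd hφP hφQ) (homologyAtMap ψ hψd hψP hψQ) := by
  have hφd' : ∀ w, φ (d₁ w) = d (φ w) := LinearMap.congr_fun hφd
  have hψd' : ∀ z, ψ (d z) = d₂ (ψ z) := LinearMap.congr_fun hψd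
  have hσd' : ∀ y, σ (d₂ y) = d (σ y) := LinearMap.congr_fun hσd
  have hσ' : ∀ y, ψ (σ y) = y := LinearMap.congr_fun hσ
  have hψφ : ∀ w, ψ (φ w) = 0 := fun w => (hexact _).2 ⟨w, rfl⟩
  have hsec : homologyAtMap ψ hψd hψP hψQ ∘ₗ homologyAtMap σ hσd hσP hσQ = LinearMap.id := by
    ext ⟨y, hy⟩
    change Submodule.Quotient.mk _ = Submodule.Quotient.mk _
    congr 1
    exact Subtype.ext (hσ' y)
  refine ⟨?_, ?_, ?_, _, hsec⟩
  · rw [injective_iff_map_eq_zero]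
    intro x hx
    obtain ⟨⟨w, hwQ, hw⟩, rfl⟩ := Submodule.Quotient.mk_surjective _ x
    change Submodule.Quotient.mk _ = _ at hx
    rw [Submodule.Quotient.mk_eq_zero] at hx ⊢
    obtain ⟨p, hp, hpw⟩ := hx
    change d p = φ w at hpw
    -- Subtracting σψp moves the primitive p of φw into the image of φ without changing its
    -- boundary, since dσψp = σψφw = 0.
    have hker : ψ (p - σ (ψ p)) = 0 := by rw [map_sub, hσ', sub_self]
    obtain ⟨v, hv⟩ := (hexact _).1 hker
    refine ⟨v, hφP' v ?_, ?_⟩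
    · rw [hv]
      exact Submodule.sub_mem _ hp (hσP (hψP hp))
    · change d₁ v = w
      apply hinj
      rw [hφd', hv, map_sub, ← hσd', ← hψd', hpw, hψφ, map_zero, sub_zero]
  · intro x
    constructor
    · intro hx
      obtain ⟨⟨z, hzQ, hz⟩, rfl⟩ := Submodule.Quotient.mk_surjective _ x
      change Submodule.Quotient.mk _ = _ at hx
      rw [Submodule.Quotient.mk_eq_zero] at hx
      obtain ⟨p, hp, hpz⟩ := hx
      change d₂ p = ψ z at hpz
      change d z = 0 at hz
      -- The boundary that kills ψz is lifted by σ; subtracting it gives a homologous cycle in the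
      -- image of φ.
      have hker : ψ (z - d (σ p)) = 0 := by rw [map_sub, hψd', hσ', hpz, sub_self]
      obtain ⟨w, hw⟩ := (hexact _).1 hker
      have hwQ : w ∈ Q₁ := by
        refine hφQ' w ?_
        rw [hw]
        exact Submodule.sub_mem _ hzQ (hdP (hσP hp))
      have hwd : d₁ w = 0 := by
        apply hinj
        have : d (d (σ p)) = 0 := LinearMap.congr_fun hdd _
        rw [hφd', hw, map_sub, hz, this, sub_zero, map_zero]
      refine ⟨Submodule.Quotient.mk ⟨w, hwQ, hwd⟩, ?_⟩
      change Submodule.Quotient.mk _ = Submodule.Quotient.mk _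
      rw [Submodule.Quotient.eq]
      refine ⟨-σ p, Submodule.neg_mem _ (hσP hp), ?_⟩
      change d (-σ p) = φ w - z
      rw [hw, map_neg]
      abel
    · rintro ⟨y, rfl⟩
      obtain ⟨⟨w, hwQ, hw⟩, rfl⟩ := Submodule.Quotient.mk_surjective _ y
      change Submodule.Quotient.mk _ = _
      rw [Submodule.Quotient.mk_eq_zero]
      refine ⟨0, Submodule.zero_mem _, ?_⟩
      change d₂ 0 = ψ (φ w)
      rw [hψφ, map_zero]
  · exact fun y => ⟨homologyAtMap σ hσd hσP hσQ y, LinearMap.congr_fun hsec y⟩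

end SplitExact

/-! ### The short exact sequence of deletion and contraction -/

section ShortExact

variable {α β : Type*} [LinearOrder β] {G : Graph α β} {e : β} {a b : α}

lemma liftState_injective (he : G.IsLink e a b) : Function.Injective (liftState he) := by
  intro S T h
  apply EnhancedState.ext
  · have h' : insert e S.edges = insert e T.edges := congrArg EnhancedState.edges h
    rw [← Finset.erase_insert (notMem_edges_contraction S), h',
      Finset.erase_insert (notMem_edges_contraction T)]
  · funext w
    obtain ⟨v, rfl⟩ := toContraction_surjective G e a b w
    exact congrFun (congrArg EnhancedState.colour h) v

/-- Contracting an edge of s identifies the components of [G : s] with those of the contracted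
graph, so the colouring descends; it is read off at chosen preimages of the vertices. -/
lemma exists_liftState_eq (he : G.IsLink e a b) (S : EnhancedState G) (hS : e ∈ S.edges) :
    ∃ T, liftState he T = S := by
  have hins : insert e (S.edges.erase e) = S.edges := Finset.insert_erase hS
  have key : ∀ u v : V(G), component (contraction G e a b) (S.edges.erase e)
      (toContraction G e a b u) = component (contraction G e a b) (S.edges.erase e)
      (toContraction G e a b v) → S.colour u = S.colour v := by
    intro u v h
    rw [component_toContraction_iff he _ (Finset.notMem_erase _ _), hins] at h
    exact S.colour_eq_of_component_eq h
  let ρ := Function.surjInv (toContraction_surjective G e a b)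
  have hρ : ∀ w, toContraction G e a b (ρ w) = w := Function.surjInv_eq _
  refine ⟨⟨S.edges.erase e, ?_, fun w => S.colour (ρ w), fun u v h => key _ _ ?_⟩, ?_⟩
  · intro f hf
    rw [Finset.mem_coe, Finset.mem_erase] at hf
    have := S.edges_subset hf.2
    simp [this, hf.1]
  · rw [hρ, hρ]
    exact Quot.sound h
  · apply EnhancedState.ext
    · exact hins
    · funext v
      exact key _ _ (by rw [hρ])

lemma alpha_apply_liftState (he : G.IsLink e a b) (w : Cochain (contraction G e a b))
    (S : EnhancedState (contraction G e a b)) :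
    alpha he w (liftState he S) = (-1) ^ (S.edges.filter (e < ·)).card * w S := by
  induction w using Finsupp.induction_linear with
  | zero => simp
  | add w w' h h' => rw [map_add, Finsupp.add_apply, h, h', Finsupp.add_apply, mul_add]
  | single T c =>
    rw [← mul_one c, ← smul_eq_mul, ← Finsupp.smul_single, map_smul, alpha_single]
    by_cases hTS : T = S
    · subst hTS
      simp [mul_comm]
    · have : liftState he T ≠ liftState he S := fun h => hTS (liftState_injective he h)
      simp [hTS, this]

lemma alpha_injective (he : G.IsLink e a b) : Function.Injective (alpha he) := by
  rw [injective_iff_map_eq_zero]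
  intro w hw
  ext S
  have h := alpha_apply_liftState he w S
  rw [hw, Finsupp.zero_apply] at h
  simpa using h.symm

/-- Up to signs `alpha` embeds one basis of states into another, hence it reflects supports and with
them degrees. -/
lemma mem_supported_of_alpha_mem (he : G.IsLink e a b)
    {p : Set (EnhancedState (contraction G e a b))}
    {q : Set (EnhancedState G)} (hpq : ∀ S, liftState he S ∈ q → S ∈ p)
    {w : Cochain (contraction G e a b)} (hw : alpha he w ∈ Finsupp.supported ℤ ℤ q) :
    w ∈ Finsupp.supported ℤ ℤ p := by
  rw [Finsupp.mem_supported] at hw ⊢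
  intro S hS
  refine hpq S (hw ?_)
  rw [Finset.mem_coe, Finsupp.mem_support_iff] at hS ⊢
  rw [alpha_apply_liftState]
  exact mul_ne_zero (pow_ne_zero _ (by norm_num)) hS

lemma alpha_beta_exact (he : G.IsLink e a b) : Function.Exact (alpha he) (beta G e) := by
  intro z
  constructor
  · intro hz
    -- This difference is the part of z on states containing e, and each such state is a lift from G
    -- / e.
    have key : ∀ z : Cochain G, z - extendCochain G e (beta G e z) ∈ LinearMap.range (alpha he) := by
      intro z
      induction z using Finsupp.induction_linear with
      | zero => simp
      | add z z' h h' =>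
        rw [map_add, map_add, add_sub_add_comm]
        exact Submodule.add_mem _ h h'
      | single S c =>
        rw [← mul_one c, ← smul_eq_mul, ← Finsupp.smul_single, map_smul, map_smul, ← smul_sub]
        refine Submodule.smul_mem _ _ ?_
        rw [beta_single]
        by_cases hS : e ∈ S.edges
        · rw [dif_pos hS, map_zero, sub_zero]
          obtain ⟨T, rfl⟩ := exists_liftState_eq he S hS
          refine ⟨(-1 : ℤ) ^ (T.edges.filter (e < ·)).card • Finsupp.single T 1, ?_⟩
          rw [map_smul, alpha_single, smul_smul, ← mul_pow]
          simp
        · rw [dif_neg hS, extendCochain_single, extendState_restrictState, sub_self]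
          exact Submodule.zero_mem _
    have := key z
    rwa [hz, map_zero, sub_zero] at this
  · rintro ⟨w, rfl⟩
    induction w using Finsupp.induction_linear with
    | zero => simp
    | add w w' h h' => rw [map_add, map_add, h, h', add_zero]
    | single T c =>
      rw [← mul_one c, ← smul_eq_mul, ← Finsupp.smul_single, map_smul, map_smul, alpha_single,
        map_smul, beta_single, dif_pos (show e ∈ (liftState he T).edges from
          Finset.mem_insert_self _ _), smul_zero, smul_zero]

variable [Fintype β]

lemma differential_gradedPart (G : Graph α β) (i : ℤ) :
    gradedPart G i ≤ (gradedPart G (i + 1)).comap (differential G) := by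
  apply supported_le_comap
  intro S hS
  have h : Finsupp.single S 1 ∈ bigradedPart G i S.xCount :=
    Finsupp.single_mem_supported _ _ ⟨hS, rfl⟩
  exact Finsupp.supported_mono (fun T hT => hT.1) (differential_bigradedPart G i _ h)

variable {σ : Cochain (deletion G e) →ₗ[ℤ] Cochain G}

theorem isSplitExact_alphaStar_betaStar (he : G.IsLink e a b)
    (hσd : σ ∘ₗ differential (deletion G e) = differential G ∘ₗ σ)
    (hσ : beta G e ∘ₗ σ = LinearMap.id)
    (hσg : ∀ i j, ∀ y ∈ bigradedPart (deletion G e) i j, σ y ∈ bigradedPart G i j) (i j : ℤ) :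
    IsSplitExact (alphaStar he i j) (betaStar G e (i + 1) j) := by
  have hcard : ∀ {k l : ℤ}, k + 1 = l → ∀ w, alpha he w ∈ bigradedPart G l j →
      w ∈ bigradedPart (contraction G e a b) k j := by
    intro k l hkl w hw
    refine mem_supported_of_alpha_mem he ?_ hw
    rintro S ⟨h1, h2⟩
    rw [card_edges_liftState] at h1
    rw [xCount_liftState] at h2
    push_cast at h1
    exact ⟨by omega, h2⟩
  refine isSplitExact_homologyAtMap _ _ _ _ _ _ (alpha_injective he) (alpha_beta_exact he)
    (hcard (by ring)) (hcard rfl) ?_ (differential_comp_differential G) hσd hσ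
    (fun y hy => hσg _ _ y hy) (fun y hy => hσg _ _ y hy)
  have := differential_bigradedPart G (i + 1 - 1) j
  rwa [sub_add_cancel] at this

theorem isSplitExact_alphaStarTotal_betaStarTotal (he : G.IsLink e a b)
    (hσd : σ ∘ₗ differential (deletion G e) = differential G ∘ₗ σ)
    (hσ : beta G e ∘ₗ σ = LinearMap.id)
    (hσg : ∀ i j, ∀ y ∈ bigradedPart (deletion G e) i j, σ y ∈ bigradedPart G i j) (i : ℤ) :
    IsSplitExact (alphaStarTotal he i) (betaStarTotal G e (i + 1)) := by
  have hcard : ∀ {k l : ℤ}, k + 1 = l → ∀ w, alpha he w ∈ gradedPart G l →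
      w ∈ gradedPart (contraction G e a b) k := by
    intro k l hkl w hw
    refine mem_supported_of_alpha_mem he ?_ hw
    intro S h1
    change ((liftState he S).edges.card : ℤ) = l at h1
    rw [card_edges_liftState] at h1
    push_cast at h1
    change (S.edges.card : ℤ) = k
    omega
  have hσg' : ∀ k, gradedPart (deletion G e) k ≤ (gradedPart G k).comap σ := by
    intro k
    apply supported_le_comap
    intro S hS
    -- A single state is bihomogeneous, so the total grading reduces to the bigraded statement, one
    -- basis element at a time.
    have h : Finsupp.single S 1 ∈ bigradedPart (deletion G e) k S.xCount :=
      Finsupp.single_mem_supported _ _ ⟨hS, rfl⟩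
    exact Finsupp.supported_mono (fun T hT => hT.1) (hσg k _ _ h)
  refine isSplitExact_homologyAtMap _ _ _ _ _ _ (alpha_injective he) (alpha_beta_exact he)
    (hcard (by ring)) (hcard rfl) ?_ (differential_comp_differential G) hσd hσ
    (hσg' _) (hσg' _)
  have := differential_gradedPart G (i + 1 - 1)
  rwa [sub_add_cancel] at this

end ShortExact

/-! ### The graph `K_{n-1}^m` -/

lemma exists_isLink_graphK {n m : ℕ} {u v : Fin n} (huv : u ≠ v) (hu : (u : ℕ) + 1 < n)
    (hv : (v : ℕ) + 1 < n) : ∃ f, (graphK n m).IsLink f u v := by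
  rcases lt_or_gt_of_ne huv with h | h
  · exact ⟨toLex (u, v), ⟨h, Or.inl hv⟩, Or.inl rfl⟩
  · exact ⟨toLex (v, u), ⟨h, Or.inl hu⟩, Or.inr rfl⟩

theorem exists_section_beta_graphK {n m : ℕ} (hn : 4 ≤ n) (hm : 2 ≤ m) (hmn : m < n)
    {a b : Fin n} (ha : (a : ℕ) + 1 = m) (hb : (b : ℕ) + 1 = n) :
    ∃ σ : Cochain (deletion (graphK n m) (toLex (a, b))) →ₗ[ℤ] Cochain (graphK n m),
      σ ∘ₗ differential (deletion (graphK n m) (toLex (a, b))) =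
        differential (graphK n m) ∘ₗ σ ∧
      beta (graphK n m) (toLex (a, b)) ∘ₗ σ = LinearMap.id ∧
      ∀ i j, ∀ y ∈ bigradedPart (deletion (graphK n m) (toLex (a, b))) i j,
        σ y ∈ bigradedPart (graphK n m) i j := by
  have hV : ∀ v : Fin n, v ∈ V(graphK n m) := fun v => Set.mem_univ v
  have hab : a ≠ b := by rw [Ne, Fin.ext_iff]; omega
  obtain ⟨u, hu⟩ : ∃ u : Fin n, (u : ℕ) = 0 := ⟨⟨0, by omega⟩, rfl⟩
  -- The path is n, 1, p, m, where p is vertex 3 if m = 2 and vertex 2 otherwise. Since n ≥ 4,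
  -- vertex 3 is still among the first n - 1.
  obtain ⟨p, hpu, hpa, hpn⟩ : ∃ p : Fin n, u ≠ p ∧ p ≠ a ∧ (p : ℕ) + 1 < n := by
    by_cases h : (a : ℕ) = 1
    · exact ⟨⟨2, by omega⟩, by rw [Ne, Fin.ext_iff]; simp [hu],
        by rw [Ne, Fin.ext_iff]; simp [h], by change 2 + 1 < n; omega⟩
    · exact ⟨⟨1, by omega⟩, by rw [Ne, Fin.ext_iff]; simp [hu],
        by rw [Ne, Fin.ext_iff]; exact fun h' => h h'.symm, by change 1 + 1 < n; omega⟩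
  have h₁ : (graphK n m).IsLink (toLex (u, b)) u b := by
    refine ⟨⟨?_, Or.inr ⟨hb, ?_⟩⟩, Or.inl rfl⟩
    · change u < b
      rw [Fin.lt_def]
      omega
    · change (u : ℕ) < m
      omega
  obtain ⟨f₂, h₂⟩ := exists_isLink_graphK (m := m) hpa hpn (by omega)
  obtain ⟨f₃, h₃⟩ := exists_isLink_graphK (m := m) hpu (by omega) hpn
  have htri : ∀ (f : Fin n ×ₗ Fin n) (t : Fin n), f ≠ toLex (a, b) →
      (graphK n m).IsLink f t b → t ≠ b ∧ ∃ g, (graphK n m).IsLink g t a := by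
    rintro f t hf ⟨⟨hlt, hE⟩, hft⟩
    have htb : ofLex f = (t, b) := by
      rcases hft with h | h
      · exact h
      -- The ends cannot come in the order (b, t), because b is the last vertex.
      · rw [h, Fin.lt_def] at hlt
        have := t.2
        simp only at hlt
        omega
    rw [htb] at hlt hE
    simp only at hlt hE
    have hta : t ≠ a := by
      rintro rfl
      exact hf (congrArg toLex htb)
    rw [Fin.lt_def] at hlt
    exact ⟨fun h => by rw [h] at hlt; omega, exists_isLink_graphK hta (by omega) (by omega)⟩
  refine exists_section_beta (a := ⟨a, hV a⟩) (b := ⟨b, hV b⟩) (u := ⟨u, hV u⟩) (p := ⟨p, hV p⟩)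
    (graphK_isLink hmn ha hb) (fun h => hab (congrArg Subtype.val h)) ?_ h₁ h₂ h₃ ?_ ?_
  · intro f t hf hft
    obtain ⟨h, h'⟩ := htri f t hf hft
    exact ⟨fun hb' => h (congrArg Subtype.val hb'), h'⟩
  -- The edge from vertex 1 to n differs from e because m ≥ 2.
  · intro h
    have : u = a := congrArg (fun x => (ofLex x).1) h
    rw [Fin.ext_iff] at this
    omega
  · intro h
    have : p = b := congrArg Subtype.val h
    rw [this] at hpn
    omega

end

end ChromaticHomology

theorem mainTheorem1 (n m : ℕ) (hn : 4 ≤ n) (hm : 2 ≤ m) (hmn : m < n)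
    (a b : Fin n) (ha : (a : ℕ) + 1 = m) (hb : (b : ℕ) + 1 = n) :
    (∀ i j : ℤ, (i + j = n - 2 ∨ i + j = n - 1 ∨ i + j = n) →
      ChromaticHomology.IsSplitExact
        (ChromaticHomology.alphaStar (ChromaticHomology.graphK_isLink hmn ha hb) i j)
        (ChromaticHomology.betaStar (ChromaticHomology.graphK n m) (toLex (a, b)) (i + 1) j)) ∧
    (∀ i : ℤ,
      ChromaticHomology.IsSplitExact
        (ChromaticHomology.alphaStarTotal (ChromaticHomology.graphK_isLink hmn ha hb) i)
        (ChromaticHomology.betaStarTotal (ChromaticHomology.graphK n m) (toLex (a, b))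
          (i + 1))) := by
  obtain ⟨σ, hσd, hσ, hσg⟩ := ChromaticHomology.exists_section_beta_graphK hn hm hmn ha hb
  exact ⟨fun i j _ => ChromaticHomology.isSplitExact_alphaStar_betaStar _ hσd hσ hσg i j,
    fun i => ChromaticHomology.isSplitExact_alphaStarTotal_betaStarTotal _ hσd hσ hσg i⟩
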